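/- **Setting.** A two-layer neural network with activation $\sigma:\mathbb R\to\mathbb R$ is a function $\mathbb R^n\to\mathbb R$ of the form $y\mapsto\sum_{j=1}^m c_j\,\sigma(w_j\cdot y+b_j)$; throughout, $\sigma$ is $C^\infty$ and not a polynomial (e.g. $\tanh$). Matrix fields $L,M:\mathbb R^n\to\mathbb R^{n\times n}$ and functions $E,S:\mathbb R^n\to\mathbb R$ are *nondegenerate metriplectic data on* $K\subset\mathbb R^n$ if $E,S$ are differentiable at every point of $K$ and, at every point of $K$, $L^\top=-L$, $M$ is symmetric positive semidefinite, $L\nabla S=M\nabla E=0$, $\nabla E\neq0$ and $\nabla S\ne 0$. A *trajectory in* $K$ is a curve $x:[0,\infty)\to K$ with $\dot x=L(x)\nabla E(x)+M(x)\nabla S(x)$ for all $t\ge 0$. The data are *defined by two-layer neural networks* if $E,S$ are two-layer networks and $$L=P_S(A-A^\top)P_S,\qquad M=P_E\,B\,(CC^\top)\,B^\top P_E,\qquad P_f=I-\frac{\nabla f\,\nabla f^\top}{|\nabla f|^2},$$ where the entries of $A$ (strictly lower triangular, $n\times n$), $B$ ($n\times r$, for some $r\le n$) and $C$ (lower triangular,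 $r\times r$) are two-layer networks. **Theorem.** Let $K\subset\mathbb R^n$ be closed and let $L,M,E,S$ be nondegenerate metriplectic data on $K$ such that $L,M$ are $C^1$ in a neighbourhood of each point of $K$, $E,S:\mathbb R^n\to\mathbb R$ are differentiable with Lipschitz continuous gradients, and at least one of $E,-S$ has bounded sublevel sets in $\mathbb R^n$. Let $x$ be a trajectory in $K$ of the corresponding system. Then there are constants $a>0$ and $b\in\mathbb R$, depending only on these data, on $x$ and on $\sigma$, such that for every $\varepsilon>0$ and every compact $Q\subset K$ there exist a compact set $\tilde K\supset Q$ that contains $x(t)$ for all $t\ge0$, data $\tilde L,\tilde M,\tilde E,\tilde S$ defined by two-layer neural networks with activation $\sigma$ that are nondegenerate metriplectic on $\tilde K$, and a trajectory $\tilde x$ in $\tilde K$ of the system with data $\tilde L,\tilde M,\tilde E,\tilde S$, with $\tilde x(0)=x(0)$, such that for all $T>0$ $$\Big(\int_0^T|x-\tilde x|^2\,dt\Big)^{1/2}\le \varepsilon\,\Big|\frac ba\Big|\sqrt{e^{2aT}-2e^{aT}+T+1}.$$ -/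

import Mathlib

open scoped Gradient ContDiff

/-- The data `L, M, E, S` form a nondegenerate metriplectic system on `K ⊆ ℝⁿ`: at every point of `K`
the matrix `L` is skew-symmetric, `M` is symmetric positive semidefinite, the degeneracy conditions
`L ∇S = 0 = M ∇E` hold, and neither `∇E` nor `∇S` vanishes. -/
structure IsNondegenerateMetriplecticOn {n : ℕ} (K : Set (EuclideanSpace ℝ (Fin n)))
    (L M : EuclideanSpace ℝ (Fin n) → Matrix (Fin n) (Fin n) ℝ)
    (E S : EuclideanSpace ℝ (Fin n) → ℝ) : Prop where
  skew : ∀ y ∈ K, (L y).transpose = -L y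
  posSemidef : ∀ y ∈ K, (M y).PosSemidef
  differentiableAt_energy : ∀ y ∈ K, DifferentiableAt ℝ E y
  differentiableAt_entropy : ∀ y ∈ K, DifferentiableAt ℝ S y
  L_gradient_entropy : ∀ y ∈ K, Matrix.toEuclideanLin (L y) (∇ S y) = 0
  M_gradient_energy : ∀ y ∈ K, Matrix.toEuclideanLin (M y) (∇ E y) = 0
  gradient_energy_ne_zero : ∀ y ∈ K, ∇ E y ≠ 0
  gradient_entropy_ne_zero : ∀ y ∈ K, ∇ S y ≠ 0

/-- The metriplectic vector field `L ∇E + M ∇S`. -/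
noncomputable def metriplecticField {n : ℕ}
    (L M : EuclideanSpace ℝ (Fin n) → Matrix (Fin n) (Fin n) ℝ)
    (E S : EuclideanSpace ℝ (Fin n) → ℝ) (y : EuclideanSpace ℝ (Fin n)) :
    EuclideanSpace ℝ (Fin n) :=
  Matrix.toEuclideanLin (L y) (∇ E y) + Matrix.toEuclideanLin (M y) (∇ S y)

/-- `x` is a trajectory in `K`, for all times `t ≥ 0`, of the metriplectic system with data
`L, M, E, S` (at `t = 0` the derivative is the one-sided one). Only the values of `x` on `[0, ∞)`
matter. -/
def IsMetriplecticTrajectory {n : ℕ} (K : Set (EuclideanSpace ℝ (Fin n)))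
    (L M : EuclideanSpace ℝ (Fin n) → Matrix (Fin n) (Fin n) ℝ)
    (E S : EuclideanSpace ℝ (Fin n) → ℝ) (x : ℝ → EuclideanSpace ℝ (Fin n)) : Prop :=
  ∀ t : ℝ, 0 ≤ t →
    x t ∈ K ∧ HasDerivWithinAt x (metriplecticField L M E S (x t)) (Set.Ici 0) t

/-- All sublevel sets of `f` are bounded. -/
def HasBoundedSublevelSets {n : ℕ} (f : EuclideanSpace ℝ (Fin n) → ℝ) : Prop :=
  ∀ c : ℝ, Bornology.IsBounded {y | f y ≤ c}

/-- `f` is a two-layer neural network (one hidden layer of finitely many units, then a linear output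
layer) with activation `σ`. An output bias `β` is not listed separately: when `σ s ≠ 0` for some `s`,
it is the unit with weight `0`, bias `s` and output coefficient `β / σ s`. -/
def IsTwoLayerNetwork {n : ℕ} (σ : ℝ → ℝ) (f : EuclideanSpace ℝ (Fin n) → ℝ) : Prop :=
  ∃ (m : ℕ) (w : Fin m → EuclideanSpace ℝ (Fin n)) (b c : Fin m → ℝ),
    ∀ y, f y = ∑ j, c j * σ (inner ℝ (w j) y + b j)

/-- A matrix field is a two-layer network when each of its entries is (the hidden layers of the
entries can be concatenated into one). -/
def IsTwoLayerMatrixNetwork {n p q : ℕ} (σ : ℝ → ℝ)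
    (A : EuclideanSpace ℝ (Fin n) → Matrix (Fin p) (Fin q) ℝ) : Prop :=
  ∀ i j, IsTwoLayerNetwork σ (fun y => A y i j)

/-- The matrix `I - ∇f ∇fᵀ / |∇f|²` of the orthogonal projection onto the complement of the span of
`∇f`; it is used only at points where `∇f ≠ 0`. -/
noncomputable def gradientProjector {n : ℕ} (f : EuclideanSpace ℝ (Fin n) → ℝ)
    (y : EuclideanSpace ℝ (Fin n)) : Matrix (Fin n) (Fin n) ℝ :=
  1 - (‖∇ f y‖ ^ 2)⁻¹ • Matrix.vecMulVec (∇ f y).ofLp (∇ f y).ofLp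

/-- The data `L, M, E, S` are defined by two-layer networks with activation `σ` (a neural metriplectic
system): `E` and `S` are two-layer networks, and
`L = P_S (A - Aᵀ) P_S`, `M = P_E B (C Cᵀ) Bᵀ P_E`,
where `P_f` is the orthogonal projector off `∇f`, and `A` (strictly lower triangular, `n × n`),
`B` (`n × r` with `r ≤ n`) and `C` (lower triangular, `r × r`) are matrices of two-layer networks. -/
def IsNeuralMetriplecticData {n : ℕ} (σ : ℝ → ℝ)
    (L M : EuclideanSpace ℝ (Fin n) → Matrix (Fin n) (Fin n) ℝ)
    (E S : EuclideanSpace ℝ (Fin n) → ℝ) : Prop :=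
  IsTwoLayerNetwork σ E ∧ IsTwoLayerNetwork σ S ∧
  (∃ A : EuclideanSpace ℝ (Fin n) → Matrix (Fin n) (Fin n) ℝ,
    IsTwoLayerMatrixNetwork σ A ∧ (∀ y i j, i ≤ j → A y i j = 0) ∧
    ∀ y, L y = gradientProjector S y * (A y - (A y).transpose) * gradientProjector S y) ∧
  (∃ r : ℕ, r ≤ n ∧
    ∃ (B : EuclideanSpace ℝ (Fin n) → Matrix (Fin n) (Fin r) ℝ)
      (C : EuclideanSpace ℝ (Fin n) → Matrix (Fin r) (Fin r) ℝ),
    IsTwoLayerMatrixNetwork σ B ∧ IsTwoLayerMatrixNetwork σ C ∧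
    (∀ y i j, i < j → C y i j = 0) ∧
    ∀ y, M y = gradientProjector E y * (B y * (C y * (C y).transpose) * (B y).transpose) *
      gradientProjector E y)

/-!
# Neural metriplectic approximation of a metriplectic trajectory

Along a metriplectic trajectory `x` the velocity `v` satisfies `⟪∇E, v⟫ = 0` and `⟪∇S, v⟫ ≥ 0`. Hence
`E` is constant and `S` nondecreasing along `x`, so that `x` stays in a bounded
sublevel set of `E` or `-S`. Conversely, a velocity `b`
with `⟪∇E, b⟫ = 0` and `⟪∇S, b⟫ > 0` equals `M ∇S` for the rank-one matrix
`M = b bᵀ / ⟪∇S, b⟫`, which is symmetric, positive semidefinite and annihilates `∇E`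
(`rankOneVelocity_eq`). So a purely dissipative neural system, with `L = 0` and a single column `b`
and scalar `c` in `M = P_E b c² bᵀ P_E`, can follow `x` once a small entropy production is added to
`v`.

* If `∇E` and `∇S` are parallel at some point of `x`, that point is an equilibrium and `x` is
  constant (`IsMetriplecticTrajectory.eq_of_field_eq_zero`). The column `b = 0` will do.
* Otherwise, on a given time interval, `v` extends to a Lipschitz field on a tube around the arc of
  `x`, tangent to the level sets of `E` and not decreasing `S` (`velocityWithRates`). Adding `δ` times
  the direction of steepest entropy increase within these level sets makes the entropy production
  positive, and the field is then of the rank-one form. Networks that approximate `∇E`, `∇S`, `b`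
  and `c` give a nearby field, and Grönwall's inequality in the tube bounds the distance of the
  trajectories (`dist_le_of_trajectories_in_tube`).

The approximating trajectory has to exist for all times in a compact set on which the network
gradients do not vanish, although nothing controls it after the chosen time interval. For this the
scalar `c` is made positive near the arc and negative on the boundary of the tube. The network
inherits these strict signs; its zeros are equilibria of the rank-one field, so no trajectory crosses
them (`exists_confined_trajectory`).

If `D` bounds the distance of the two curves for all times, closeness up to the time `D² / ε²`
suffices: later, the exponential on the right-hand side dominates `D² T`
(`sqrt_integral_sq_norm_sub_le`). The constants `a = b = 1` are therefore enough.

The networks come from a universal approximation theorem in `C¹`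
(`exists_network_gradient_near`). Differentiating `σ (a s + b)` repeatedly in the weight `a` produces
all monomials in one variable, hence the exponentials `exp ⟪w, y⟫` in `n` variables. These span an
algebra, so that they are uniformly dense by the Stone-Weierstrass theorem, and they are
eigenfunctions of convolutions. Convolving the function with a bump that is approximated by
exponentials therefore approximates it in `C¹`.
-/

/-! ### Uniform closure of a space of functions -/

section UniformClosure

open Filter Topology

variable {X F : Type*} [NormedAddCommGroup F] [NormedSpace ℝ F]

/-- The functions that are uniform limits on `K` of members of the function space `W`. The members
are total functions, whose values off `K` are unconstrained. -/
def uniformClosureOn (W : Submodule ℝ (X → F)) (K : Set X) : Submodule ℝ (X → F) where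
  carrier := {g | ∀ κ : ℝ, 0 < κ → ∃ N ∈ W, ∀ s ∈ K, ‖N s - g s‖ ≤ κ}
  zero_mem' := fun κ hκ => ⟨0, W.zero_mem, fun s _ => by simpa using hκ.le⟩
  add_mem' := by
    intro g₁ g₂ h₁ h₂ κ hκ
    obtain ⟨N₁, hN₁, h₁⟩ := h₁ (κ / 2) (half_pos hκ)
    obtain ⟨N₂, hN₂, h₂⟩ := h₂ (κ / 2) (half_pos hκ)
    refine ⟨N₁ + N₂, W.add_mem hN₁ hN₂, fun s hs => ?_⟩
    calc ‖(N₁ + N₂) s - (g₁ + g₂) s‖ = ‖(N₁ s - g₁ s) + (N₂ s - g₂ s)‖ := by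
          simp only [Pi.add_apply]; congr 1; abel
      _ ≤ κ / 2 + κ / 2 := (norm_add_le _ _).trans (add_le_add (h₁ s hs) (h₂ s hs))
      _ = κ := add_halves κ
  smul_mem' := by
    intro c g h κ hκ
    obtain ⟨N, hN, h⟩ := h (κ / (|c| + 1)) (by positivity)
    refine ⟨c • N, W.smul_mem c hN, fun s hs => ?_⟩
    calc ‖(c • N) s - (c • g) s‖ = |c| * ‖N s - g s‖ := by
          rw [Pi.smul_apply, Pi.smul_apply, ← smul_sub, norm_smul, Real.norm_eq_abs]
      _ ≤ (|c| + 1) * (κ / (|c| + 1)) := by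
          gcongr
          · linarith
          · exact h s hs
      _ = κ := by field_simp

theorem le_uniformClosureOn (W : Submodule ℝ (X → F)) (K : Set X) :
    W ≤ uniformClosureOn W K :=
  fun g hg κ hκ => ⟨g, hg, fun s _ => by simpa using hκ.le⟩

theorem mem_uniformClosureOn_of_approx {W : Submodule ℝ (X → F)} {K : Set X} {g : X → F}
    (h : ∀ κ : ℝ, 0 < κ → ∃ N ∈ uniformClosureOn W K, ∀ s ∈ K, ‖N s - g s‖ ≤ κ) :
    g ∈ uniformClosureOn W K := by
  intro κ hκ
  obtain ⟨N, hN, h⟩ := h (κ / 2) (half_pos hκ)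
  obtain ⟨N', hN', h'⟩ := hN (κ / 2) (half_pos hκ)
  refine ⟨N', hN', fun s hs => ?_⟩
  calc ‖N' s - g s‖ ≤ ‖N' s - N s‖ + ‖N s - g s‖ := norm_sub_le_norm_sub_add_norm_sub _ _ _
    _ ≤ κ / 2 + κ / 2 := add_le_add (h' s hs) (h s hs)
    _ = κ := add_halves κ

theorem uniformClosureOn_mono {W W' : Submodule ℝ (X → F)} {K : Set X}
    (h : W ≤ uniformClosureOn W' K) : uniformClosureOn W K ≤ uniformClosureOn W' K := by
  intro g hg
  refine mem_uniformClosureOn_of_approx fun κ hκ => ?_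
  obtain ⟨N, hN, hNg⟩ := hg κ hκ
  exact ⟨N, h hN, hNg⟩

/-- A jointly continuous family whose members with nonzero parameter lie in the closure has its
member at `0` in the closure, since it converges uniformly on compact sets. -/
theorem mem_uniformClosureOn_of_continuous [TopologicalSpace X] {W : Submodule ℝ (X → F)}
    {K : Set X} (hK : IsCompact K) {φ : ℝ → X → F}
    (hφ : Continuous fun p : ℝ × X => φ p.1 p.2)
    (h : ∀ t, t ≠ 0 → φ t ∈ uniformClosureOn W K) : φ 0 ∈ uniformClosureOn W K := by
  refine mem_uniformClosureOn_of_approx fun κ hκ => ?_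
  have key : ∀ᶠ t in 𝓝 (0 : ℝ), ∀ s ∈ K, ‖φ t s - φ 0 s‖ < κ := by
    refine hK.eventually_forall_of_forall_eventually fun s _ => ?_
    have hc : Continuous fun p : ℝ × X => ‖φ p.1 p.2 - φ 0 p.2‖ :=
      (hφ.sub (hφ.comp (continuous_const.prodMk continuous_snd))).norm
    have := hc.tendsto (0, s)
    simp only [sub_self, norm_zero] at this
    exact this.eventually (gt_mem_nhds hκ)
  obtain ⟨t, ht, ht0⟩ :=
    ((key.filter_mono (nhdsWithin_le_nhds (s := {0}ᶜ))).and self_mem_nhdsWithin).exists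
  exact ⟨φ t, h t ht0, fun s hs => (ht s hs).le⟩

end UniformClosure

/-! ### Density of the translates and dilates of a smooth nonpolynomial function -/

section OneDimensional

open Filter Topology Polynomial

theorem exists_polynomial_of_deriv {τ : ℝ → ℝ} (hτ : Differentiable ℝ τ) (p : ℝ[X])
    (h : ∀ s, deriv τ s = p.eval s) : ∃ q : ℝ[X], ∀ s, τ s = q.eval s := by
  have anti : ∀ p : ℝ[X], ∃ q : ℝ[X], derivative q = p := by
    intro p
    induction p using Polynomial.induction_on' with
    | add p q hp hq =>
      obtain ⟨p', rfl⟩ := hp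
      obtain ⟨q', rfl⟩ := hq
      exact ⟨p' + q', derivative_add⟩
    | monomial n a =>
      refine ⟨monomial (n + 1) (a / (n + 1)), ?_⟩
      rw [derivative_monomial]
      have : (n : ℝ) + 1 ≠ 0 := by positivity
      simp only [Nat.add_sub_cancel, Nat.cast_add, Nat.cast_one]
      rw [div_mul_cancel₀ _ this]
  obtain ⟨q, hq⟩ := anti p
  have hconst : ∀ s, τ s - q.eval s = τ 0 - q.eval 0 := by
    intro s
    refine is_const_of_deriv_eq_zero (f := fun s => τ s - q.eval s)
      (hτ.sub q.differentiable) (fun t => ?_) s 0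
    rw [deriv_fun_sub (hτ t) q.differentiableAt, h t, Polynomial.deriv, hq, sub_self]
  refine ⟨q + C (τ 0 - q.eval 0), fun s => ?_⟩
  rw [eval_add, eval_C, ← hconst s]
  ring

theorem exists_iteratedDeriv_ne_zero {τ : ℝ → ℝ} (hτ : ContDiff ℝ ∞ τ)
    (hpoly : ¬ ∃ p : ℝ[X], ∀ s, τ s = p.eval s) (k : ℕ) : ∃ b, iteratedDeriv k τ b ≠ 0 := by
  induction k generalizing τ with
  | zero =>
    by_contra! h
    exact hpoly ⟨0, fun s => by simpa using h s⟩
  | succ k ih =>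
    have hτ' : ContDiff ℝ ∞ (deriv τ) := (contDiff_infty_iff_deriv.1 hτ).2
    obtain ⟨b, hb⟩ := ih hτ' fun ⟨p, hp⟩ =>
      hpoly (exists_polynomial_of_deriv (hτ.differentiable (by simp)) p hp)
    exact ⟨b, by rwa [iteratedDeriv_succ']⟩

/-- The span of the functions `s ↦ τ (a * s + b)` with `a ≠ 0`. -/
def ridgeSpan (τ : ℝ → ℝ) : Submodule ℝ (ℝ → ℝ) :=
  Submodule.span ℝ {g | ∃ a b : ℝ, a ≠ 0 ∧ g = fun s => τ (a * s + b)}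

/-- The first-order difference quotients of a `C¹` function converge locally uniformly. -/
theorem exists_forall_abs_sub_sub_le {τ : ℝ → ℝ} (hτ : ContDiff ℝ 1 τ) (R : ℝ) {κ : ℝ}
    (hκ : 0 < κ) :
    ∃ δ > 0, ∀ u ∈ Set.Icc (-R) R, ∀ d : ℝ, |d| ≤ δ →
      |τ (u + d) - τ u - d * deriv τ u| ≤ κ * |d| := by
  have hc : Continuous (deriv τ) := hτ.continuous_deriv (le_refl _)
  have hu := (isCompact_Icc (a := -R) (b := R)).uniformContinuousAt_of_continuousAt (deriv τ)
    (fun a _ => hc.continuousAt) (Metric.dist_mem_uniformity hκ)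
  obtain ⟨δ, hδ, hu⟩ := Metric.mem_uniformity_dist.1 hu
  refine ⟨δ / 2, half_pos hδ, fun u hu' d hd => ?_⟩
  have hdiff : Differentiable ℝ τ := hτ.differentiable (by simp)
  have := (convex_closedBall u |d|).norm_image_sub_le_of_norm_deriv_le
    (f := fun v => τ v - v * deriv τ u) (C := κ) (x := u) (y := u + d)
    (fun v _ => (hdiff v).sub (by fun_prop)) ?_ (by simp) (by simp)
  · calc |τ (u + d) - τ u - d * deriv τ u|
        = ‖τ (u + d) - (u + d) * deriv τ u - (τ u - u * deriv τ u)‖ := by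
          rw [Real.norm_eq_abs]; congr 1; ring
      _ ≤ κ * ‖u + d - u‖ := this
      _ = κ * |d| := by simp
  · intro v hv
    rw [deriv_fun_sub (hdiff v) (by fun_prop)]
    simp only [deriv_mul_const_field, deriv_id'', one_mul]
    have hvu : dist u v < δ := by
      rw [dist_comm]
      exact (Metric.mem_closedBall.1 hv).trans_lt (by linarith)
    have := hu hvu hu'
    rw [Set.mem_ofPred_eq] at this
    rw [← dist_eq_norm, dist_comm]
    exact this.le

/-- The span of the ridge functions of `τ` contains, in its closure, the `k`-th derivatives in the
weight `a`, because these are limits of difference quotients. -/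
theorem pow_mul_iteratedDeriv_mem_uniformClosureOn {τ : ℝ → ℝ} (hτ : ContDiff ℝ ∞ τ) (R : ℝ)
    (k : ℕ) (a b : ℝ) :
    (fun s => s ^ k * iteratedDeriv k τ (a * s + b)) ∈
      uniformClosureOn (ridgeSpan τ) (Set.Icc (-R) R) := by
  induction k generalizing a with
  | zero =>
    simp only [pow_zero, iteratedDeriv_zero, one_mul]
    by_cases ha : a = 0
    · subst ha
      refine mem_uniformClosureOn_of_continuous isCompact_Icc
        (φ := fun t s => τ (t * s + b)) ?_ ?_
      · exact hτ.continuous.comp (by fun_prop)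
      · intro t ht
        exact le_uniformClosureOn _ _ (Submodule.subset_span ⟨t, b, ht, rfl⟩)
    · exact le_uniformClosureOn _ _ (Submodule.subset_span ⟨a, b, ha, rfl⟩)
  | succ k ih =>
    refine mem_uniformClosureOn_of_approx fun κ hκ => ?_
    have hk : ContDiff ℝ 1 (iteratedDeriv k τ) := by
      rw [iteratedDeriv_eq_iterate]
      exact (hτ.iterate_deriv k).of_le (by simp)
    set ρ : ℝ := |R| + 1 with hρ
    have hρ0 : 0 < ρ := by positivity
    obtain ⟨δ, hδ, H⟩ := exists_forall_abs_sub_sub_le hk (|a| * ρ + |b|)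
      (κ := κ / ρ ^ (k + 1)) (by positivity)
    set h : ℝ := δ / ρ with hh
    have hh0 : 0 < h := by positivity
    refine ⟨fun s => h⁻¹ * (s ^ k * iteratedDeriv k τ ((a + h) * s + b) -
      s ^ k * iteratedDeriv k τ (a * s + b)), ?_, ?_⟩
    · exact Submodule.smul_mem _ h⁻¹ (Submodule.sub_mem _ (ih (a + h)) (ih a))
    · intro s hs
      have hs' : |s| ≤ ρ := by
        rw [abs_le]
        have := le_abs_self R
        exact ⟨by linarith [hs.1], by linarith [hs.2]⟩
      have hmem : a * s + b ∈ Set.Icc (-(|a| * ρ + |b|)) (|a| * ρ + |b|) := by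
        rw [Set.mem_Icc, ← abs_le]
        calc |a * s + b| ≤ |a| * |s| + |b| := (abs_add_le _ _).trans (by rw [abs_mul])
          _ ≤ |a| * ρ + |b| := by gcongr
      have hd : |h * s| ≤ δ := by
        rw [abs_mul, abs_of_pos hh0]
        calc h * |s| ≤ h * ρ := by gcongr
          _ = δ := by rw [hh]; field_simp
      have := H _ hmem _ hd
      rw [iteratedDeriv_succ, Real.norm_eq_abs]
      have e1 : (a + h) * s + b = a * s + b + h * s := by ring
      beta_reduce
      rw [e1]
      set A := iteratedDeriv k τ (a * s + b + h * s)
      set B := iteratedDeriv k τ (a * s + b)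
      set D := deriv (iteratedDeriv k τ) (a * s + b)
      have e2 : h⁻¹ * (s ^ k * A - s ^ k * B) - s ^ (k + 1) * D
          = h⁻¹ * s ^ k * (A - B - h * s * D) := by
        field_simp
        ring
      rw [e2, abs_mul, abs_mul, abs_of_pos (inv_pos.2 hh0), abs_pow]
      calc h⁻¹ * |s| ^ k * |A - B - h * s * D|
          ≤ h⁻¹ * |s| ^ k * (κ / ρ ^ (k + 1) * |h * s|) := by gcongr
        _ = |s| ^ (k + 1) * (κ / ρ ^ (k + 1)) := by
            rw [abs_mul, abs_of_pos hh0]; field_simp; ring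
        _ ≤ ρ ^ (k + 1) * (κ / ρ ^ (k + 1)) := by gcongr
        _ = κ := by field_simp

/-- The one-dimensional universal approximation theorem for a smooth nonpolynomial `τ`, with all
weights nonzero. -/
theorem mem_uniformClosureOn_ridgeSpan {τ : ℝ → ℝ} (hτ : ContDiff ℝ ∞ τ)
    (hpoly : ¬ ∃ p : ℝ[X], ∀ s, τ s = p.eval s) (R : ℝ) {g : ℝ → ℝ} (hg : Continuous g) :
    g ∈ uniformClosureOn (ridgeSpan τ) (Set.Icc (-R) R) := by
  have hpow : ∀ k : ℕ, (fun s : ℝ => s ^ k) ∈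
      uniformClosureOn (ridgeSpan τ) (Set.Icc (-R) R) := by
    intro k
    obtain ⟨b, hb⟩ := exists_iteratedDeriv_ne_zero hτ hpoly k
    have := Submodule.smul_mem _ (iteratedDeriv k τ b)⁻¹
      (pow_mul_iteratedDeriv_mem_uniformClosureOn hτ R k 0 b)
    convert this using 1
    ext s
    simp only [Pi.smul_apply, smul_eq_mul, zero_mul, zero_add]
    field_simp
  have hp : ∀ p : ℝ[X], (fun s : ℝ => p.eval s) ∈
      uniformClosureOn (ridgeSpan τ) (Set.Icc (-R) R) := by
    intro p
    induction p using Polynomial.induction_on' with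
    | add p q hp hq =>
      convert Submodule.add_mem _ hp hq using 1
      ext s
      simp
    | monomial n a =>
      convert Submodule.smul_mem _ a (hpow n) using 1
      ext s
      simp
  refine mem_uniformClosureOn_of_approx fun κ hκ => ?_
  obtain ⟨p, hpκ⟩ := exists_polynomial_near_of_continuousOn (-R) R g hg.continuousOn κ hκ
  exact ⟨_, hp p, fun s hs => (hpκ s hs).le⟩

end OneDimensional

/-! ### Uniform density of exponentials -/

section Exponentials

variable {V : Type*} [NormedAddCommGroup V] [InnerProductSpace ℝ V]

/-- The span of the exponentials `y ↦ exp ⟪w, y⟫`. -/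
def expSpan (V : Type*) [NormedAddCommGroup V] [InnerProductSpace ℝ V] : Submodule ℝ (V → ℝ) :=
  Submodule.span ℝ (Set.range fun (w : V) (y : V) => Real.exp (inner ℝ w y))

theorem exp_inner_mem_expSpan (w : V) : (fun y : V => Real.exp (inner ℝ w y)) ∈ expSpan V :=
  Submodule.subset_span ⟨w, rfl⟩

theorem mul_mem_expSpan {f g : V → ℝ} (hf : f ∈ expSpan V) (hg : g ∈ expSpan V) :
    f * g ∈ expSpan V := by
  have h : expSpan V * expSpan V ≤ expSpan V := by
    rw [expSpan, Submodule.span_mul_span, Submodule.span_le]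
    rintro _ ⟨_, ⟨w, rfl⟩, _, ⟨v, rfl⟩, rfl⟩
    refine Submodule.subset_span ⟨w + v, ?_⟩
    ext y
    simp [inner_add_left, Real.exp_add]
  exact h (Submodule.mul_mem_mul hf hg)

theorem continuous_of_mem_expSpan {f : V → ℝ} (hf : f ∈ expSpan V) : Continuous f := by
  induction hf using Submodule.span_induction with
  | mem f hf => obtain ⟨w, rfl⟩ := hf; fun_prop
  | zero => exact continuous_const
  | add f g _ _ hf hg => exact hf.add hg
  | smul c f _ hf => exact hf.const_smul c

/-- The restrictions of linear combinations of exponentials to `K`, as an algebra of continuous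
functions. -/
def expSubalgebra (K : Set V) : Subalgebra ℝ C(K, ℝ) where
  carrier := {f | ∃ N ∈ expSpan V, ∀ y : K, f y = N y}
  mul_mem' := by
    rintro f g ⟨N, hN, hf⟩ ⟨M, hM, hg⟩
    exact ⟨N * M, mul_mem_expSpan hN hM, fun y => by simp [hf, hg]⟩
  add_mem' := by
    rintro f g ⟨N, hN, hf⟩ ⟨M, hM, hg⟩
    exact ⟨N + M, Submodule.add_mem _ hN hM, fun y => by simp [hf, hg]⟩
  algebraMap_mem' := by
    intro r
    refine ⟨_, Submodule.smul_mem _ r (exp_inner_mem_expSpan (0 : V)), fun y => ?_⟩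
    simp

theorem mem_uniformClosureOn_expSpan {K : Set V} (hK : IsCompact K) {g : V → ℝ}
    (hg : ContinuousOn g K) : g ∈ uniformClosureOn (expSpan V) K := by
  intro κ hκ
  have : CompactSpace K := isCompact_iff_compactSpace.1 hK
  have hsep : (expSubalgebra K).SeparatesPoints := by
    intro p q hpq
    set w : V := (p : V) - q with hw
    refine ⟨fun y : K => Real.exp (inner ℝ w (y : V)),
      ⟨⟨fun y : K => Real.exp (inner ℝ w (y : V)), by fun_prop⟩,
        ⟨_, exp_inner_mem_expSpan w, fun y => rfl⟩, rfl⟩, ?_⟩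
    intro h
    have h0 : inner ℝ w ((p : V) - q) = 0 := by
      rw [inner_sub_right, sub_eq_zero]
      exact Real.exp_injective h
    rw [← hw, inner_self_eq_zero, hw, sub_eq_zero] at h0
    exact hpq (Subtype.ext h0)
  obtain ⟨⟨f, N, hN, hf⟩, hfg⟩ :=
    ContinuousMap.exists_mem_subalgebra_near_continuousMap_of_separatesPoints _ hsep
      ⟨K.domRestrict g, hg.domRestrict⟩ κ hκ
  refine ⟨N, hN, fun y hy => ?_⟩
  have := (ContinuousMap.norm_coe_le_norm _ (⟨y, hy⟩ : K)).trans hfg.le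
  simpa [hf] using this

end Exponentials

/-! ### Networks as a function space -/

section Networks

variable {n : ℕ}

local notation "V" => EuclideanSpace ℝ (Fin n)

theorem IsTwoLayerNetwork.zero (σ : ℝ → ℝ) : IsTwoLayerNetwork σ (fun _ : V => 0) :=
  ⟨0, Fin.elim0, Fin.elim0, Fin.elim0, fun y => by simp⟩

theorem IsTwoLayerNetwork.unit (σ : ℝ → ℝ) (w : V) (b c : ℝ) :
    IsTwoLayerNetwork σ (fun y : V => c * σ (inner ℝ w y + b)) :=
  ⟨1, fun _ => w, fun _ => b, fun _ => c, fun y => by simp⟩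

theorem IsTwoLayerNetwork.add {σ : ℝ → ℝ} {f g : V → ℝ} (hf : IsTwoLayerNetwork σ f)
    (hg : IsTwoLayerNetwork σ g) : IsTwoLayerNetwork σ (fun y => f y + g y) := by
  obtain ⟨m, w, b, c, hf⟩ := hf
  obtain ⟨m', w', b', c', hg⟩ := hg
  refine ⟨m + m', Fin.append w w', Fin.append b b', Fin.append c c', fun y => ?_⟩
  beta_reduce
  rw [Fin.sum_univ_add, hf, hg]
  simp

theorem IsTwoLayerNetwork.const_mul {σ : ℝ → ℝ} {f : V → ℝ} (hf : IsTwoLayerNetwork σ f)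
    (a : ℝ) : IsTwoLayerNetwork σ (fun y => a * f y) := by
  obtain ⟨m, w, b, c, hf⟩ := hf
  refine ⟨m, w, b, fun j => a * c j, fun y => ?_⟩
  simp [hf, Finset.mul_sum, mul_assoc]

theorem IsTwoLayerNetwork.const {σ : ℝ → ℝ}
    (hpoly : ¬ ∃ p : Polynomial ℝ, ∀ s, σ s = p.eval s) (a : ℝ) :
    IsTwoLayerNetwork σ (fun _ : V => a) := by
  have : ∃ b, σ b ≠ 0 := by
    by_contra! h
    exact hpoly ⟨0, fun s => by simpa using h s⟩
  obtain ⟨b, hb⟩ := this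
  convert IsTwoLayerNetwork.unit σ (0 : V) b (a / σ b) using 2
  simp [hb]

theorem IsTwoLayerNetwork.contDiff {σ : ℝ → ℝ} (hσ : ContDiff ℝ ∞ σ) {f : V → ℝ}
    (hf : IsTwoLayerNetwork σ f) : ContDiff ℝ ∞ f := by
  obtain ⟨m, w, b, c, hf⟩ := hf
  rw [funext hf]
  refine ContDiff.sum fun j _ => contDiff_const.mul (hσ.comp ?_)
  exact (contDiff_const.inner ℝ contDiff_id).add contDiff_const

/-- The two-layer networks on `ℝⁿ` form a vector space. -/
def networkSpace (n : ℕ) (σ : ℝ → ℝ) : Submodule ℝ (EuclideanSpace ℝ (Fin n) → ℝ) where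
  carrier := {f | IsTwoLayerNetwork σ f}
  zero_mem' := IsTwoLayerNetwork.zero σ
  add_mem' := fun hf hg => hf.add hg
  smul_mem' := fun a _ hf => hf.const_mul a

/-- The gradient fields of two-layer networks. -/
def networkGradientSpace (n : ℕ) (σ : ℝ → ℝ) :
    Submodule ℝ (EuclideanSpace ℝ (Fin n) → EuclideanSpace ℝ (Fin n)) where
  carrier := {G | ∃ f, IsTwoLayerNetwork σ f ∧ ∀ y, HasGradientAt f (G y) y}
  zero_mem' := ⟨_, IsTwoLayerNetwork.zero σ, fun y => hasGradientAt_const y 0⟩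
  add_mem' := by
    rintro G H ⟨f, hf, hG⟩ ⟨g, hg, hH⟩
    refine ⟨_, hf.add hg, fun y => ?_⟩
    rw [hasGradientAt_iff_hasFDerivAt, Pi.add_apply, map_add]
    exact (hG y).hasFDerivAt.add (hH y).hasFDerivAt
  smul_mem' := by
    rintro a G ⟨f, hf, hG⟩
    refine ⟨_, hf.const_mul a, fun y => ?_⟩
    rw [hasGradientAt_iff_hasFDerivAt, Pi.smul_apply, map_smul]
    exact (hG y).hasFDerivAt.const_mul a

theorem exists_antideriv_of_mem_ridgeSpan {σ : ℝ → ℝ} (hσ : Differentiable ℝ σ) {g : ℝ → ℝ}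
    (hg : g ∈ ridgeSpan (deriv σ)) :
    ∃ P : ℝ → ℝ, (∀ s, HasDerivAt P (g s) s) ∧
      ∀ w : V, IsTwoLayerNetwork σ (fun y => P (inner ℝ w y)) := by
  induction hg using Submodule.span_induction with
  | mem g hg =>
    obtain ⟨a, b, ha, rfl⟩ := hg
    refine ⟨fun s => a⁻¹ * σ (a * s + b), fun s => ?_, fun w => ?_⟩
    · have h1 : HasDerivAt (fun s : ℝ => a * s + b) a s := by
        simpa using ((hasDerivAt_id s).const_mul a).add_const b
      have := ((hσ (a * s + b)).hasDerivAt.comp s h1).const_mul a⁻¹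
      exact this.congr_deriv (by field_simp)
    · convert IsTwoLayerNetwork.unit σ (a • w) b a⁻¹ using 4
      rw [real_inner_smul_left]
  | zero => exact ⟨fun _ => 0, fun s => hasDerivAt_const s 0, fun w => IsTwoLayerNetwork.zero σ⟩
  | add f g _ _ hf hg =>
    obtain ⟨P, hP, hPn⟩ := hf
    obtain ⟨Q, hQ, hQn⟩ := hg
    exact ⟨fun s => P s + Q s, fun s => (hP s).add (hQ s), fun w => (hPn w).add (hQn w)⟩
  | smul c g _ hg =>
    obtain ⟨P, hP, hPn⟩ := hg
    exact ⟨fun s => c * P s, fun s => (hP s).const_mul c, fun w => (hPn w).const_mul c⟩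

/-- One-dimensional networks approximate the exponential in `C¹` on bounded intervals. -/
theorem exists_network_near_exp {σ : ℝ → ℝ} (hσ : ContDiff ℝ ∞ σ)
    (hpoly : ¬ ∃ p : Polynomial ℝ, ∀ s, σ s = p.eval s) (R : ℝ) {κ : ℝ} (hκ : 0 < κ) :
    ∃ P P' : ℝ → ℝ, (∀ s, HasDerivAt P (P' s) s) ∧
      (∀ w : V, IsTwoLayerNetwork σ (fun y => P (inner ℝ w y))) ∧
      ∀ s ∈ Set.Icc (-R) R, |P s - Real.exp s| ≤ κ ∧ |P' s - Real.exp s| ≤ κ := by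
  have hdiff : Differentiable ℝ σ := hσ.differentiable (by simp)
  have hσ' : ContDiff ℝ ∞ (deriv σ) := (contDiff_infty_iff_deriv.1 hσ).2
  have hpoly' : ¬ ∃ p : Polynomial ℝ, ∀ s, deriv σ s = p.eval s :=
    fun ⟨p, hp⟩ => hpoly (exists_polynomial_of_deriv hdiff p hp)
  obtain ⟨P', hP'mem, hP'⟩ := mem_uniformClosureOn_ridgeSpan hσ' hpoly' R Real.continuous_exp
    (κ / (|R| + 1)) (by positivity)
  obtain ⟨P, hP, hPn⟩ := exists_antideriv_of_mem_ridgeSpan (n := n) hdiff hP'mem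
  have hle : κ / (|R| + 1) ≤ κ := div_le_self hκ.le (by linarith [abs_nonneg R])
  refine ⟨fun s => P s + (1 - P 0), P', fun s => (hP s).add_const _,
    fun w => (hPn w).add (IsTwoLayerNetwork.const hpoly _), fun s hs => ⟨?_, (hP' s hs).trans hle⟩⟩
  have h0 : (0 : ℝ) ∈ Set.Icc (-R) R := by
    have : -R ≤ R := hs.1.trans hs.2
    exact ⟨by linarith, by linarith⟩
  have := (convex_Icc (-R) R).norm_image_sub_le_of_norm_hasDerivWithin_le
    (f := fun s => P s - Real.exp s) (C := κ / (|R| + 1))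
    (fun t _ => ((hP t).sub (Real.hasDerivAt_exp t)).hasDerivWithinAt) hP' h0 hs
  calc |P s + (1 - P 0) - Real.exp s| = ‖P s - Real.exp s - (P 0 - Real.exp 0)‖ := by
        rw [Real.norm_eq_abs, Real.exp_zero]; congr 1; ring
    _ ≤ κ / (|R| + 1) * ‖s - 0‖ := this
    _ ≤ κ / (|R| + 1) * (|R| + 1) := by
        gcongr
        rw [sub_zero, Real.norm_eq_abs]
        have : |s| ≤ R := abs_le.2 hs
        linarith [le_abs_self R]
    _ = κ := by field_simp

theorem exists_forall_inner_mem_Icc {K : Set V} (hK : IsCompact K) (w : V) :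
    ∃ R : ℝ, ∀ y ∈ K, inner ℝ w y ∈ Set.Icc (-R) R := by
  obtain ⟨R, hR⟩ := hK.exists_bound_of_continuousOn (f := fun y => inner ℝ w y) (by fun_prop)
  exact ⟨R, fun y hy => abs_le.1 (hR y hy)⟩

theorem exp_inner_mem_uniformClosureOn {σ : ℝ → ℝ} (hσ : ContDiff ℝ ∞ σ)
    (hpoly : ¬ ∃ p : Polynomial ℝ, ∀ s, σ s = p.eval s) {K : Set V} (hK : IsCompact K) (w : V) :
    (fun y : V => Real.exp (inner ℝ w y)) ∈ uniformClosureOn (networkSpace n σ) K := by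
  intro κ hκ
  obtain ⟨R, hR⟩ := exists_forall_inner_mem_Icc hK w
  obtain ⟨P, P', -, hPn, hPe⟩ := exists_network_near_exp (n := n) hσ hpoly R hκ
  exact ⟨_, hPn w, fun y hy => (hPe _ (hR y hy)).1⟩

/-- **Universal approximation**: two-layer networks are uniformly dense in the continuous
functions on a compact set. -/
theorem exists_network_near {σ : ℝ → ℝ} (hσ : ContDiff ℝ ∞ σ)
    (hpoly : ¬ ∃ p : Polynomial ℝ, ∀ s, σ s = p.eval s) {K : Set V} (hK : IsCompact K)
    {g : V → ℝ} (hg : ContinuousOn g K) {κ : ℝ} (hκ : 0 < κ) :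
    ∃ N : V → ℝ, IsTwoLayerNetwork σ N ∧ ∀ y ∈ K, |N y - g y| ≤ κ := by
  have h : expSpan V ≤ uniformClosureOn (networkSpace n σ) K := by
    rw [expSpan, Submodule.span_le]
    rintro _ ⟨w, rfl⟩
    exact exp_inner_mem_uniformClosureOn hσ hpoly hK w
  exact uniformClosureOn_mono h (mem_uniformClosureOn_expSpan hK hg) κ hκ

theorem exp_inner_smul_mem_uniformClosureOn {σ : ℝ → ℝ} (hσ : ContDiff ℝ ∞ σ)
    (hpoly : ¬ ∃ p : Polynomial ℝ, ∀ s, σ s = p.eval s) {K : Set V} (hK : IsCompact K) (w : V) :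
    (fun y : V => Real.exp (inner ℝ w y) • w) ∈
      uniformClosureOn (networkGradientSpace n σ) K := by
  intro κ hκ
  obtain ⟨R, hR⟩ := exists_forall_inner_mem_Icc hK w
  obtain ⟨P, P', hP, hPn, hPe⟩ := exists_network_near_exp (n := n) hσ hpoly R
    (κ := κ / (‖w‖ + 1)) (by positivity)
  refine ⟨fun y => P' (inner ℝ w y) • w, ⟨_, hPn w, fun y => ?_⟩, fun y hy => ?_⟩
  · rw [hasGradientAt_iff_hasFDerivAt]
    have h1 : HasFDerivAt (fun y : V => inner ℝ w y) (innerSL ℝ w) y :=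
      (innerSL ℝ w).hasFDerivAt
    refine ((hP (inner ℝ w y)).comp_hasFDerivAt y h1).congr_fderiv ?_
    ext v
    simp
  · rw [← sub_smul, norm_smul, Real.norm_eq_abs]
    calc |P' (inner ℝ w y) - Real.exp (inner ℝ w y)| * ‖w‖
        ≤ κ / (‖w‖ + 1) * (‖w‖ + 1) := by
          gcongr
          · exact (hPe _ (hR y hy)).2
          · linarith
      _ = κ := by field_simp

end Networks

/-! ### Approximation in `C¹` -/

section GradientApproximation

open MeasureTheory

variable {n : ℕ}

local notation "V" => EuclideanSpace ℝ (Fin n)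

theorem continuous_gradient {f : V → ℝ} (hf : ContDiff ℝ 1 f) : Continuous (∇ f) :=
  (InnerProductSpace.toDual ℝ V).symm.continuous.comp (hf.continuous_fderiv (by simp))

theorem contDiff_one_of_continuous_gradient {f : V → ℝ} (hf : Differentiable ℝ f)
    (hc : Continuous (∇ f)) : ContDiff ℝ 1 f := by
  rw [contDiff_one_iff_fderiv]
  refine ⟨hf, ?_⟩
  have : fderiv ℝ f = fun y => InnerProductSpace.toDual ℝ V (∇ f y) := by
    ext1 y
    simp [gradient]
  rw [this]
  exact (InnerProductSpace.toDual ℝ V).continuous.comp hc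

/-- Convolving the gradient of a compactly supported function with an exponential gives a multiple
of that exponential's gradient, by an integration by parts. -/
theorem integral_exp_smul_gradient {f : V → ℝ} (hf : ContDiff ℝ 1 f) (hfc : HasCompactSupport f)
    (w y : V) :
    ∫ z, Real.exp (inner ℝ w (y - z)) • ∇ f z =
      (∫ z, f z * Real.exp (-inner ℝ w z)) • (Real.exp (inner ℝ w y) • w) := by
  have hgc : HasCompactSupport (∇ f) := by
    refine (hfc.fderiv (𝕜 := ℝ)).comp_left (g := (InnerProductSpace.toDual ℝ V).symm) ?_
    simp
  have hcont := continuous_gradient hf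
  have hint : ∀ e : V → ℝ, Continuous e → Integrable (fun z => e z • ∇ f z) := fun e he =>
    (he.smul hcont).integrable_of_hasCompactSupport hgc.smul_left
  have hexp : ∀ z, HasFDerivAt (fun z : V => Real.exp (-inner ℝ w z))
      (Real.exp (-inner ℝ w z) • -innerSL ℝ w) z := fun z =>
    ((innerSL ℝ w).hasFDerivAt (x := z)).neg.exp
  have parts : ∫ z, Real.exp (-inner ℝ w z) • ∇ f z =
      (∫ z, f z * Real.exp (-inner ℝ w z)) • w := by
    refine ext_inner_left ℝ fun v => ?_
    rw [← integral_inner (hint _ (by fun_prop)), real_inner_smul_right]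
    have h1 := integral_mul_fderiv_eq_neg_fderiv_mul_of_integrable (μ := volume) (f := f)
      (g := fun z : V => Real.exp (-inner ℝ w z)) (v := v) ?_ ?_ ?_
      (fun z _ => hf.differentiable (by simp) z) (fun z _ => (hexp z).differentiableAt)
    · calc ∫ z, inner ℝ v (Real.exp (-inner ℝ w z) • ∇ f z)
          = ∫ z, fderiv ℝ f z v * Real.exp (-inner ℝ w z) := by
            congr 1; ext z
            rw [real_inner_smul_right, real_inner_comm _ v, inner_gradient_left, mul_comm]
        _ = -∫ z, f z * fderiv ℝ (fun z : V => Real.exp (-inner ℝ w z)) z v := by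
            rw [h1, neg_neg]
        _ = inner ℝ v w * ∫ z, f z * Real.exp (-inner ℝ w z) := by
            rw [← integral_neg, ← integral_const_mul]
            congr 1; ext z
            rw [(hexp z).fderiv]
            simp only [smul_apply, neg_apply,
              innerSL_apply_apply, smul_eq_mul]
            rw [real_inner_comm v w]
            ring
        _ = (∫ z, f z * Real.exp (-inner ℝ w z)) * inner ℝ v w := mul_comm _ _
    · have := (hint (fun z => Real.exp (-inner ℝ w z)) (by fun_prop)).inner_const (𝕜 := ℝ) v
      refine this.congr (Filter.Eventually.of_forall fun z => ?_)
      beta_reduce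
      rw [real_inner_smul_left, inner_gradient_left, mul_comm]
    · have he : Continuous fun z => fderiv ℝ (fun z : V => Real.exp (-inner ℝ w z)) z v := by
        simp only [(hexp _).fderiv]
        simp only [smul_apply, neg_apply,
              innerSL_apply_apply, smul_eq_mul]
        fun_prop
      exact (hf.continuous.mul he).integrable_of_hasCompactSupport hfc.mul_right
    · exact (hf.continuous.mul (by fun_prop)).integrable_of_hasCompactSupport hfc.mul_right
  have e : ∀ z, Real.exp (inner ℝ w (y - z)) • ∇ f z =
      Real.exp (inner ℝ w y) • (Real.exp (-inner ℝ w z) • ∇ f z) := fun z => by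
    rw [smul_smul, ← Real.exp_add, inner_sub_right, sub_eq_add_neg]
  simp_rw [e]
  rw [integral_smul, parts, smul_comm]

/-- **Universal approximation in `C¹`**: the gradients of two-layer networks are uniformly dense, on
a compact set, in the continuous gradient fields. A mollification of the function is a convolution
with a bump, the bump is nearly a combination of exponentials, and convolution with an exponential
only produces a multiple of it. -/
theorem exists_network_gradient_near {σ : ℝ → ℝ} (hσ : ContDiff ℝ ∞ σ)
    (hpoly : ¬ ∃ p : Polynomial ℝ, ∀ s, σ s = p.eval s) {K : Set V} (hK : IsCompact K)
    {f : V → ℝ} (hf : ContDiff ℝ 1 f) {κ : ℝ} (hκ : 0 < κ) :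
    ∃ N : V → ℝ, IsTwoLayerNetwork σ N ∧ ∀ y ∈ K, ‖∇ N y - ∇ f y‖ ≤ κ := by
  obtain ⟨R, hR0, hKR⟩ := hK.isBounded.subset_ball_lt 0 (0 : V)
  let χ : ContDiffBump (0 : V) := ⟨R, R + 1, hR0, by linarith⟩
  set g : V → ℝ := fun y => χ y * f y with hg
  have hgC : ContDiff ℝ 1 g := χ.contDiff.mul hf
  have hgc : HasCompactSupport g := χ.hasCompactSupport.mul_right
  have hgf : ∀ y ∈ K, ∇ g y = ∇ f y := by
    intro y hy
    have : g =ᶠ[nhds y] f := by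
      filter_upwards [Metric.isOpen_ball.mem_nhds (hKR hy)] with z hz
      have : χ z = 1 := χ.one_of_mem_closedBall (Metric.ball_subset_closedBall hz)
      simp [hg, this]
    unfold gradient
    rw [this.fderiv_eq]
  have hGcont := continuous_gradient hgC
  have hGc : HasCompactSupport (∇ g) := by
    refine (hgc.fderiv (𝕜 := ℝ)).comp_left (g := (InnerProductSpace.toDual ℝ V).symm) ?_
    simp
  obtain ⟨ρ, hρ, hu⟩ := Metric.uniformContinuous_iff.1
    (hGc.uniformContinuous_of_continuous hGcont) (κ / 2) (half_pos hκ)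
  let φ : ContDiffBump (0 : V) := ⟨ρ / 2, ρ, half_pos hρ, half_lt_self hρ⟩
  have hconv : ∀ y, ‖(∫ z, φ.normed volume (y - z) • ∇ g z) - ∇ g y‖ ≤ κ / 2 := by
    intro y
    have := φ.dist_normed_convolution_le (μ := volume) (x₀ := y) (g := ∇ g) (ε := κ / 2)
      hGcont.aestronglyMeasurable (fun z hz => (hu hz).le)
    rwa [convolution_lsmul_swap, dist_eq_norm] at this
  set I : ℝ := ∫ z, ‖∇ g z‖ with hI
  have hI0 : 0 ≤ I := integral_nonneg fun z => norm_nonneg _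
  obtain ⟨r, hr⟩ := hGc.isCompact.isBounded.subset_closedBall (0 : V)
  obtain ⟨p, hp, hpφ⟩ := mem_uniformClosureOn_expSpan
    (isCompact_closedBall (0 : V) (R + r)) (φ.continuous_normed (μ := volume)).continuousOn
    (κ / 4 / (I + 1)) (by positivity)
  have hint : ∀ e : V → ℝ, Continuous e → ∀ y, Integrable (fun z => e (y - z) • ∇ g z) :=
    fun e he y => ((he.comp (continuous_const.sub continuous_id)).smul
      hGcont).integrable_of_hasCompactSupport hGc.smul_left
  have hmem : ∀ q ∈ expSpan V, (fun y => ∫ z, q (y - z) • ∇ g z) ∈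
      uniformClosureOn (networkGradientSpace n σ) K := by
    intro q hq
    induction hq using Submodule.span_induction with
    | mem q hq =>
      obtain ⟨w, rfl⟩ := hq
      simp_rw [integral_exp_smul_gradient hgC hgc]
      exact Submodule.smul_mem _ _ (exp_inner_smul_mem_uniformClosureOn hσ hpoly hK w)
    | zero =>
      simp only [Pi.zero_apply, zero_smul, integral_zero]
      exact Submodule.zero_mem _
    | add p q hp hq h1 h2 =>
      convert Submodule.add_mem _ h1 h2 using 1
      ext1 y
      simp only [Pi.add_apply, add_smul]
      exact integral_add (hint p (continuous_of_mem_expSpan hp) y)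
        (hint q (continuous_of_mem_expSpan hq) y)
    | smul c p hp h1 =>
      convert Submodule.smul_mem _ c h1 using 1
      ext1 y
      simp only [Pi.smul_apply, smul_assoc]
      exact integral_smul _ _
  obtain ⟨G, ⟨N, hN, hNG⟩, hG⟩ := hmem p hp (κ / 4) (by positivity)
  refine ⟨N, hN, fun y hy => ?_⟩
  rw [(hNG y).gradient, ← hgf y hy]
  have hpφ' : ‖(∫ z, p (y - z) • ∇ g z) - ∫ z, φ.normed volume (y - z) • ∇ g z‖ ≤ κ / 4 := by
    rw [← integral_sub (hint p (continuous_of_mem_expSpan hp) y)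
      (hint _ φ.continuous_normed y)]
    calc ‖∫ z, (p (y - z) • ∇ g z - φ.normed volume (y - z) • ∇ g z)‖
        ≤ ∫ z, κ / 4 / (I + 1) * ‖∇ g z‖ := by
          refine norm_integral_le_of_norm_le
            ((hGcont.integrable_of_hasCompactSupport hGc).norm.const_mul _)
            (Filter.Eventually.of_forall fun z => ?_)
          rw [← sub_smul, norm_smul]
          by_cases hz : ∇ g z = 0
          · simp [hz]
          · gcongr
            refine hpφ _ ?_
            have hz1 := hr (subset_tsupport _ hz)
            have hy1 := hKR hy
            rw [mem_closedBall_zero_iff] at hz1 ⊢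
            rw [mem_ball_zero_iff] at hy1
            exact (norm_sub_le _ _).trans (add_le_add hy1.le hz1)
      _ = κ / 4 * (I / (I + 1)) := by rw [integral_const_mul, ← hI]; ring
      _ ≤ κ / 4 * 1 := by
          gcongr
          exact (div_le_one (by positivity)).2 (by linarith)
      _ = κ / 4 := mul_one _
  calc ‖G y - ∇ g y‖
      ≤ ‖G y - ∫ z, p (y - z) • ∇ g z‖ +
        ‖(∫ z, p (y - z) • ∇ g z) - ∫ z, φ.normed volume (y - z) • ∇ g z‖ +
        ‖(∫ z, φ.normed volume (y - z) • ∇ g z) - ∇ g y‖ := by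
        refine (norm_sub_le_norm_sub_add_norm_sub _ (∫ z, φ.normed volume (y - z) • ∇ g z) _).trans ?_
        gcongr
        exact norm_sub_le_norm_sub_add_norm_sub _ _ _
    _ ≤ κ / 4 + κ / 4 + κ / 2 := add_le_add (add_le_add (hG y hy) hpφ') (hconv y)
    _ = κ := by ring

end GradientApproximation

/-! ### Trajectories confined by equilibria -/

section Dynamics

open Set Filter Topology
open scoped NNReal

variable {V : Type*} [NormedAddCommGroup V] [NormedSpace ℝ V]

theorem exists_forall_hasDerivAt_of_lipschitzWith [CompleteSpace V] {F : V → V} {C M : ℝ≥0}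
    (hF : LipschitzWith C F) (hM : ∀ y, ‖F y‖ ≤ M) (x₀ : V) :
    ∃ x : ℝ → V, x 0 = x₀ ∧ ∀ t, HasDerivAt x (F (x t)) t := by
  have hloc : ∀ k : ℕ, ∃ α : ℝ → V, α 0 = x₀ ∧
      ∀ t ∈ Ioo (-(k : ℝ)) k, HasDerivAt α (F (α t)) t := by
    intro k
    have hk : (0 : ℝ) ∈ Icc (-(k : ℝ)) k := by simp
    have hPL : IsPicardLindelof (fun _ => F) (⟨0, hk⟩ : Icc (-(k : ℝ)) k) x₀ (M * k) 0 M C :=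
      { lipschitzOnWith := fun _ _ => hF.lipschitzOnWith
        continuousOn := fun _ _ => continuousOn_const
        norm_le := fun _ _ y _ => hM y
        mul_max_le := by simp }
    obtain ⟨α, hα0, hα⟩ := hPL.exists_eq_forall_mem_Icc_hasDerivWithinAt₀
    exact ⟨α, hα0, fun t ht =>
      (hα t (Ioo_subset_Icc_self ht)).hasDerivAt (Icc_mem_nhds ht.1 ht.2)⟩
  choose α hα0 hα using hloc
  have hagree : ∀ j k : ℕ, j ≤ k → EqOn (α j) (α k) (Ioo (-(j : ℝ)) j) := by
    intro j k hjk t ht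
    have hj : (0 : ℝ) < j := by linarith [ht.1, ht.2]
    have hjk' : (j : ℝ) ≤ k := Nat.cast_le.2 hjk
    refine ODE_solution_unique_of_mem_Ioo (v := fun _ => F) (s := fun _ => univ) (K := C)
      (t₀ := 0) (fun _ _ => hF.lipschitzOnWith) ⟨by linarith, hj⟩
      (fun s hs => ⟨hα j s hs, trivial⟩)
      (fun s hs => ⟨hα k s ⟨by linarith [hs.1], by linarith [hs.2]⟩, trivial⟩) ?_ ht
    rw [hα0, hα0]
  set m : ℝ → ℕ := fun t => ⌈|t|⌉₊ + 1 with hm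
  have hmem : ∀ t, t ∈ Ioo (-(m t : ℝ)) (m t) := by
    intro t
    rw [mem_Ioo, ← abs_lt]
    have := Nat.le_ceil |t|
    push_cast [hm]
    linarith
  refine ⟨fun t => α (m t) t, hα0 _, fun t => ?_⟩
  have heq : (fun s => α (m s) s) =ᶠ[𝓝 t] α (m t) := by
    filter_upwards [Ioo_mem_nhds (hmem t).1 (hmem t).2] with s hs
    rcases le_total (m s) (m t) with h | h
    · exact hagree _ _ h (hmem s)
    · exact (hagree _ _ h hs).symm
  exact (hα _ t (hmem t)).congr_of_eventuallyEq heq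

/-- If a Lipschitz field vanishes on the frontier of `G`, then extending it by zero outside `G`
keeps the Lipschitz constant: a segment that leaves `G` meets the frontier. -/
theorem lipschitzWith_indicator_of_frontier {G N : Set V} (hGN : closure G ⊆ N) {f : V → V}
    {C : ℝ≥0} (hf : LipschitzOnWith C f N) (hfr : ∀ y ∈ frontier G, f y = 0) :
    LipschitzWith C (G.indicator f) := by
  have hGN' : G ⊆ N := subset_closure.trans hGN
  have cross : ∀ y ∈ G, ∀ z ∉ G, ‖f y‖ ≤ C * dist y z := by
    intro y hy z hz
    obtain ⟨p, hps, hpf⟩ : (segment ℝ y z ∩ frontier G).Nonempty := by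
      by_contra hne
      rw [not_nonempty_iff_eq_empty] at hne
      have hsub := (convex_segment y z).isPreconnected.subset_of_closure_inter_subset
        (u := interior G) isOpen_interior ⟨y, left_mem_segment ℝ y z, ?_⟩ ?_
      · exact hz (interior_subset (hsub (right_mem_segment ℝ y z)))
      · by_contra hyi
        have : y ∈ segment ℝ y z ∩ frontier G :=
          ⟨left_mem_segment ℝ y z, subset_closure hy, hyi⟩
        rw [hne] at this
        exact this
      · rintro p ⟨hp1, hp2⟩
        by_contra hpi
        have : p ∈ segment ℝ y z ∩ frontier G :=
          ⟨hp2, closure_mono interior_subset hp1, hpi⟩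
        rw [hne] at this
        exact this
    calc ‖f y‖ = dist (f y) (f p) := by rw [hfr p hpf, dist_zero_right]
      _ ≤ C * dist y p := hf.dist_le_mul y (hGN' hy) p (hGN (frontier_subset_closure hpf))
      _ ≤ C * dist y z := by
          gcongr
          rw [← dist_add_dist_of_mem_segment hps]
          exact le_add_of_nonneg_right dist_nonneg
  refine LipschitzWith.of_dist_le_mul fun y z => ?_
  by_cases hy : y ∈ G <;> by_cases hz : z ∈ G
  · rw [indicator_of_mem hy, indicator_of_mem hz]
    exact hf.dist_le_mul y (hGN' hy) z (hGN' hz)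
  · rw [indicator_of_mem hy, indicator_of_notMem hz, dist_zero_right]
    exact cross y hy z hz
  · rw [indicator_of_notMem hy, indicator_of_mem hz, dist_zero_left, dist_comm]
    exact cross z hz y hy
  · rw [indicator_of_notMem hy, indicator_of_notMem hz, dist_self]
    positivity

/-- A Lipschitz field that vanishes on the frontier of a relatively compact set `G` has, from each
point of `G`, a trajectory that stays in `G` for all times. -/
theorem exists_trajectory_of_frontier [CompleteSpace V] {G N : Set V} (hN : IsCompact N)
    (hGN : closure G ⊆ N) {f : V → V} {C : ℝ≥0} (hf : LipschitzOnWith C f N)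
    (hfr : ∀ y ∈ frontier G, f y = 0) {x₀ : V} (hx₀ : x₀ ∈ G) :
    ∃ x : ℝ → V, x 0 = x₀ ∧ ∀ t, x t ∈ G ∧ HasDerivAt x (f (x t)) t := by
  have hlip := lipschitzWith_indicator_of_frontier hGN hf hfr
  obtain ⟨M, hM⟩ := hN.exists_bound_of_continuousOn hf.continuousOn
  have hbound : ∀ y, ‖G.indicator f y‖ ≤ M.toNNReal := by
    intro y
    by_cases hy : y ∈ G
    · rw [indicator_of_mem hy]
      exact (hM y (hGN (subset_closure hy))).trans (Real.le_coe_toNNReal M)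
    · rw [indicator_of_notMem hy, norm_zero]
      positivity
  obtain ⟨x, hx0, hx⟩ := exists_forall_hasDerivAt_of_lipschitzWith hlip hbound x₀
  have hG : ∀ t, x t ∈ G := by
    intro t
    -- A point off `G` is an equilibrium of the extended field, so it is not reached from `G`.
    by_contra ht
    have heq : x = fun _ => x t := ODE_solution_unique_univ (v := fun _ => G.indicator f)
      (s := fun _ => univ) (K := C) (t₀ := t) (fun _ => hlip.lipschitzOnWith)
      (fun s => ⟨hx s, trivial⟩)
      (fun s => ⟨by rw [indicator_of_notMem ht]; exact hasDerivAt_const s _, trivial⟩) rfl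
    have h0 : x t = x₀ := by rw [← hx0]; exact (congrFun heq 0).symm
    exact ht (h0 ▸ hx₀)
  refine ⟨x, hx0, fun t => ⟨hG t, ?_⟩⟩
  simpa only [indicator_of_mem (hG t)] using hx t

/-- A continuous function that is small at `0` stays below `r` as long as the bound `r` on an
initial interval improves itself to a strict one. -/
theorem forall_lt_of_bootstrap {φ : ℝ → ℝ} {T r : ℝ} (hφ : ContinuousOn φ (Icc 0 T))
    (h0 : φ 0 < r) (hboot : ∀ t ∈ Icc 0 T, (∀ s ∈ Icc 0 t, φ s ≤ r) → φ t < r) :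
    ∀ t ∈ Icc 0 T, φ t < r := by
  by_contra! hbad
  set A : Set ℝ := Icc 0 T ∩ φ ⁻¹' Ici r with hA
  have hAc : IsCompact A :=
    isCompact_Icc.of_isClosed_subset (hφ.preimage_isClosed_of_isClosed isClosed_Icc isClosed_Ici)
      inter_subset_left
  obtain ⟨t, ht⟩ := hbad
  obtain ⟨m, hm, hmin⟩ := hAc.exists_isLeast ⟨t, ht⟩
  have hlt : ∀ s ∈ Icc 0 T, s < m → φ s < r := by
    intro s hs hsm
    by_contra! hle
    exact absurd (hmin ⟨hs, hle⟩) (not_le.2 hsm)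
  have hmr : φ m ≤ r := by
    obtain ⟨s, hs, hsr⟩ := intermediate_value_Icc hm.1.1
      (hφ.mono (Icc_subset_Icc_right hm.1.2)) ⟨h0.le, hm.2⟩
    have hsA : s ∈ A := ⟨⟨hs.1, hs.2.trans hm.1.2⟩, hsr.ge⟩
    rw [le_antisymm (hmin hsA) hs.2, hsr]
  refine absurd (hboot m hm.1 fun s hs => ?_) (not_lt.2 hm.2)
  rcases hs.2.eq_or_lt with rfl | hsm
  · exact hmr
  · exact (hlt s ⟨hs.1, hs.2.trans hm.1.2⟩ hsm).le

theorem gronwallBound_le_mul {K ε T t : ℝ} (hK : 0 ≤ K) (hε : 0 ≤ ε) (ht : t ∈ Icc 0 T) :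
    gronwallBound 0 K ε t ≤ ε * gronwallBound 0 K 1 T := by
  have h1 : gronwallBound 0 K ε T = ε * gronwallBound 0 K 1 T := by
    by_cases h : K = 0
    · subst h; simp [gronwallBound_K0]
    · simp only [gronwallBound_of_K_ne_0 h]; ring
  rw [← h1]
  exact gronwallBound_mono le_rfl hε hK ht.2

/-- **Grönwall's inequality in a tube**: if `g` is within `ε` of the field `h` on the tube of radius
`r` around a trajectory of `h`, and `ε` is small enough, then the trajectory of `g` from the same
point stays in the tube. -/
theorem dist_le_of_trajectories_in_tube {h g : V → V} {N : Set V} {C : ℝ≥0} {ε r T : ℝ}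
    {x y : ℝ → V} (hr : 0 < r) (hε : 0 ≤ ε)
    (hlip : LipschitzOnWith C h N)
    (hN : ∀ t ∈ Icc 0 T, ∀ z, dist z (x t) ≤ r → z ∈ N ∧ dist (g z) (h z) ≤ ε)
    (hx : ∀ t ∈ Icc 0 T, HasDerivWithinAt x (h (x t)) (Ici 0) t)
    (hy : ∀ t ∈ Icc 0 T, HasDerivWithinAt y (g (y t)) (Ici 0) t)
    (h0 : y 0 = x 0) (hsmall : ε * gronwallBound 0 C 1 T < r) :
    ∀ t ∈ Icc 0 T, dist (y t) (x t) ≤ ε * gronwallBound 0 C 1 T := by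
  have hxc : ContinuousOn x (Icc 0 T) := fun t ht =>
    (hx t ht).continuousWithinAt.mono Icc_subset_Ici_self
  have hyc : ContinuousOn y (Icc 0 T) := fun t ht =>
    (hy t ht).continuousWithinAt.mono Icc_subset_Ici_self
  have hgron : ∀ t ∈ Icc 0 T, (∀ s ∈ Icc 0 t, dist (y s) (x s) ≤ r) →
      dist (y t) (x t) ≤ ε * gronwallBound 0 C 1 T := by
    intro t ht hs
    have hsub : Icc 0 t ⊆ Icc 0 T := Icc_subset_Icc_right ht.2
    have hIco : ∀ s ∈ Ico 0 t, s ∈ Icc 0 T := fun s hs => hsub (Ico_subset_Icc_self hs)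
    have := dist_le_of_approx_trajectories_ODE_of_mem (v := fun _ => h) (s := fun _ => N) (K := C)
      (f := y) (g := x) (f' := fun s => g (y s)) (g' := fun s => h (x s)) (a := 0) (b := t)
      (εf := ε) (εg := 0) (δ := 0) (fun _ _ => hlip) (hyc.mono hsub)
      (fun s hs => (hy s (hIco s hs)).mono (Ici_subset_Ici.2 hs.1))
      (fun s hs' => (hN s (hIco s hs') _ (hs s (Ico_subset_Icc_self hs'))).2)
      (fun s hs' => (hN s (hIco s hs') _ (hs s (Ico_subset_Icc_self hs'))).1)
      (hxc.mono hsub)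
      (fun s hs => (hx s (hIco s hs)).mono (Ici_subset_Ici.2 hs.1))
      (fun s _ => (dist_self _).le)
      (fun s hs' => (hN s (hIco s hs') _ (by rw [dist_self]; exact hr.le)).1)
      (by rw [h0, dist_self]) t ⟨ht.1, le_rfl⟩
    rw [add_zero, sub_zero] at this
    exact this.trans (gronwallBound_le_mul C.2 hε ht)
  have hlt := forall_lt_of_bootstrap (φ := fun t => dist (y t) (x t)) (T := T) (r := r)
    (continuous_dist.comp_continuousOn (hyc.prodMk hxc)) (by simpa [h0] using hr) fun t ht hs => (hgron t ht hs).trans_lt hsmall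
  exact fun t ht => hgron t ht fun s hs => (hlt s ⟨hs.1, hs.2.trans ht.2⟩).le

end Dynamics

/-! ### Velocities with prescribed rates of energy and entropy -/

section Velocity

variable {V : Type*} [NormedAddCommGroup V] [InnerProductSpace ℝ V]

/-- The orthogonal projection of `v` off the line spanned by `e`; it is `v` itself when `e = 0`. -/
noncomputable def projOff (e v : V) : V := v - (‖e‖ ^ 2)⁻¹ • inner ℝ e v • e

theorem inner_projOff_self {e : V} (he : e ≠ 0) (v : V) : inner ℝ e (projOff e v) = 0 := by
  have : ‖e‖ ≠ 0 := norm_ne_zero_iff.2 he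
  rw [projOff, inner_sub_right, real_inner_smul_right, real_inner_smul_right,
    real_inner_self_eq_norm_sq]
  field_simp
  ring

theorem projOff_of_inner_eq_zero {e v : V} (h : inner ℝ e v = 0) : projOff e v = v := by
  simp [projOff, h]

theorem inner_projOff_comm (e v w : V) : inner ℝ (projOff e v) w = inner ℝ v (projOff e w) := by
  simp only [projOff, inner_sub_left, inner_sub_right, real_inner_smul_left,
    real_inner_smul_right, real_inner_comm e v]
  ring

theorem inner_projOff_projOff {e : V} (he : e ≠ 0) (v w : V) :
    inner ℝ (projOff e v) (projOff e w) = inner ℝ (projOff e v) w := by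
  rw [inner_projOff_comm e v w, inner_projOff_comm e v,
    projOff_of_inner_eq_zero (inner_projOff_self he w)]

theorem inner_projOff_self_right {e : V} (he : e ≠ 0) (s : V) :
    inner ℝ (projOff e s) s = ‖projOff e s‖ ^ 2 := by
  rw [← inner_projOff_projOff he, real_inner_self_eq_norm_sq]

/-- The velocity closest to `F` that is orthogonal to `e` and has inner product `u` with `s`. It is
meaningful when `e` and `s` are linearly independent, that is `e ≠ 0` and `projOff e s ≠ 0`. -/
noncomputable def velocityWithRates (e s F : V) (u : ℝ) : V :=
  projOff e F +
    ((u - inner ℝ (projOff e s) F) * (inner ℝ (projOff e s) s)⁻¹) • projOff e s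

theorem inner_velocityWithRates_left {e s : V} (he : e ≠ 0) (F : V) (u : ℝ) :
    inner ℝ e (velocityWithRates e s F u) = 0 := by
  rw [velocityWithRates, inner_add_right, real_inner_smul_right, inner_projOff_self he,
    inner_projOff_self he, mul_zero, add_zero]

theorem inner_velocityWithRates_right {e s : V} (he : e ≠ 0) (hs : projOff e s ≠ 0) (F : V)
    (u : ℝ) : inner ℝ s (velocityWithRates e s F u) = u := by
  have h : inner ℝ (projOff e s) s ≠ 0 := by
    rw [inner_projOff_self_right he]
    have := norm_ne_zero_iff.2 hs
    positivity
  rw [velocityWithRates, inner_add_right, real_inner_smul_right, ← inner_projOff_comm,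
    real_inner_comm _ s]
  field_simp
  ring

theorem velocityWithRates_eq {e s F : V} (he : inner ℝ e F = 0) :
    velocityWithRates e s F (inner ℝ s F) = F := by
  rw [velocityWithRates, inner_projOff_comm, projOff_of_inner_eq_zero he]
  simp

theorem velocityWithRates_add (e s F : V) (u δ : ℝ) :
    velocityWithRates e s F (u + δ) = velocityWithRates e s F u +
      δ • velocityWithRates e s 0 1 := by
  have h0 : projOff e (0 : V) = 0 := by simp [projOff]
  simp only [velocityWithRates, h0, inner_zero_right, sub_zero, zero_add]
  module

/-- The velocity `M s` for the rank-one matrix `M = c² q qᵀ`, where `q` is the projection of `b` off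
`e`. -/
noncomputable def rankOneVelocity (e s b : V) (c : ℝ) : V :=
  (c ^ 2 * inner ℝ (projOff e b) s) • projOff e b

/-- Every velocity orthogonal to `e` that has a positive inner product with `s` arises from a
rank-one matrix that annihilates `e`. -/
theorem rankOneVelocity_eq {e s b : V} (he : inner ℝ e b = 0) (hs : 0 < inner ℝ s b) (χ : ℝ) :
    rankOneVelocity e s b (χ * (Real.sqrt (inner ℝ s b))⁻¹) = χ ^ 2 • b := by
  rw [rankOneVelocity, projOff_of_inner_eq_zero he, mul_pow, inv_pow, Real.sq_sqrt hs.le,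
    real_inner_comm s b, mul_assoc, inv_mul_cancel₀ hs.ne', mul_one]

theorem contDiffAt_projOff {X : Type*} [NormedAddCommGroup X] [NormedSpace ℝ X] {e v : X → V}
    {p : X} {k : WithTop ℕ∞} (he : ContDiffAt ℝ k e p) (hv : ContDiffAt ℝ k v p)
    (hp : e p ≠ 0) : ContDiffAt ℝ k (fun q => projOff (e q) (v q)) p := by
  have : ‖e p‖ ^ 2 ≠ 0 := pow_ne_zero _ (norm_ne_zero_iff.2 hp)
  exact hv.sub (((he.norm_sq ℝ).inv this).smul ((he.inner ℝ hv).smul he))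

theorem contDiffAt_rankOneVelocity {X : Type*} [NormedAddCommGroup X] [NormedSpace ℝ X]
    {e s b : X → V} {c : X → ℝ} {p : X} {k : WithTop ℕ∞} (he : ContDiffAt ℝ k e p)
    (hs : ContDiffAt ℝ k s p) (hb : ContDiffAt ℝ k b p) (hc : ContDiffAt ℝ k c p)
    (hp : e p ≠ 0) :
    ContDiffAt ℝ k (fun q => rankOneVelocity (e q) (s q) (b q) (c q)) p :=
  ((hc.pow 2).mul ((contDiffAt_projOff he hb hp).inner ℝ hs)).smul (contDiffAt_projOff he hb hp)

theorem contDiffAt_velocityWithRates {X : Type*} [NormedAddCommGroup X] [NormedSpace ℝ X]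
    {e s F : X → V} {u : X → ℝ} {p : X} {k : WithTop ℕ∞} (he : ContDiffAt ℝ k e p)
    (hs : ContDiffAt ℝ k s p) (hF : ContDiffAt ℝ k F p) (hu : ContDiffAt ℝ k u p)
    (hp : e p ≠ 0) (hp' : projOff (e p) (s p) ≠ 0) :
    ContDiffAt ℝ k (fun q => velocityWithRates (e q) (s q) (F q) (u q)) p := by
  have h : inner ℝ (projOff (e p) (s p)) (s p) ≠ 0 := by
    rw [inner_projOff_self_right hp]
    exact pow_ne_zero _ (norm_ne_zero_iff.2 hp')
  have hv := contDiffAt_projOff he hs hp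
  exact (contDiffAt_projOff he hF hp).add (((hu.sub (hv.inner ℝ hF)).mul ((hv.inner ℝ hs).inv h)).smul hv)

end Velocity

/-! ### Functions that are Lipschitz near a point -/

section LipschitzNear

open Topology
open scoped NNReal

variable {X Y Z : Type*} [NormedAddCommGroup X] [NormedAddCommGroup Y] [NormedAddCommGroup Z]

/-- `f` is Lipschitz on some neighbourhood of `x`. -/
def LipschitzNear (f : X → Y) (x : X) : Prop :=
  ∃ C : ℝ≥0, ∃ U ∈ 𝓝 x, LipschitzOnWith C f U

theorem LipschitzWith.lipschitzNear {f : X → Y} {C : ℝ≥0} (hf : LipschitzWith C f) (x : X) :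
    LipschitzNear f x :=
  ⟨C, Set.univ, Filter.univ_mem, hf.lipschitzOnWith⟩

theorem LipschitzNear.continuousAt {f : X → Y} {x : X} (hf : LipschitzNear f x) :
    ContinuousAt f x := by
  obtain ⟨C, U, hU, hf⟩ := hf
  exact hf.continuousOn.continuousAt hU

theorem LipschitzNear.comp {g : Y → Z} {f : X → Y} {x : X} (hg : LipschitzNear g (f x))
    (hf : LipschitzNear f x) : LipschitzNear (fun y => g (f y)) x := by
  have hc := hf.continuousAt
  obtain ⟨C, U, hU, hf⟩ := hf
  obtain ⟨D, W, hW, hg⟩ := hg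
  exact ⟨D * C, U ∩ f ⁻¹' W, Filter.inter_mem hU (hc hW),
    hg.comp (hf.mono Set.inter_subset_left) fun y hy => hy.2⟩

theorem LipschitzNear.prodMk {f : X → Y} {g : X → Z} {x : X} (hf : LipschitzNear f x)
    (hg : LipschitzNear g x) : LipschitzNear (fun y => (f y, g y)) x := by
  obtain ⟨C, U, hU, hf⟩ := hf
  obtain ⟨D, W, hW, hg⟩ := hg
  exact ⟨max C D, U ∩ W, Filter.inter_mem hU hW,
    (hf.mono Set.inter_subset_left).prodMk (hg.mono Set.inter_subset_right)⟩

theorem LipschitzNear.eventually {f : X → Y} {x : X} (hf : LipschitzNear f x) :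
    ∀ᶠ y in 𝓝 x, LipschitzNear f y := by
  obtain ⟨C, U, hU, hf⟩ := hf
  obtain ⟨W, hWU, hW, hx⟩ := mem_nhds_iff.1 hU
  filter_upwards [hW.mem_nhds hx] with y hy
  exact ⟨C, W, hW.mem_nhds hy, hf.mono hWU⟩

theorem ContDiffAt.lipschitzNear [NormedSpace ℝ X] [NormedSpace ℝ Y] {f : X → Y} {x : X}
    (hf : ContDiffAt ℝ 1 f x) : LipschitzNear f x := by
  obtain ⟨C, U, hU, h⟩ := hf.exists_lipschitzOnWith
  exact ⟨C, U, hU, h⟩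

theorem exists_lipschitzOnWith_of_lipschitzNear {f : X → Y} {K : Set X} (hK : IsCompact K)
    (hf : ∀ x ∈ K, LipschitzNear f x) : ∃ C : ℝ≥0, LipschitzOnWith C f K := by
  refine LocallyLipschitzOn.exists_lipschitzOnWith_of_compact hK fun x hx => ?_
  obtain ⟨C, U, hU, h⟩ := hf x hx
  exact ⟨C, U, mem_nhdsWithin_of_mem_nhds hU, h⟩

end LipschitzNear

/-! ### Metriplectic data -/

section Metriplectic

variable {n : ℕ}

local notation "V" => EuclideanSpace ℝ (Fin n)

theorem ofLp_toEuclideanLin (A : Matrix (Fin n) (Fin n) ℝ) (v : V) :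
    (Matrix.toEuclideanLin A v).ofLp = A.mulVec v.ofLp :=
  rfl

theorem inner_toEuclideanLin (A : Matrix (Fin n) (Fin n) ℝ) (u v : V) :
    inner ℝ u (Matrix.toEuclideanLin A v) = inner ℝ (Matrix.toEuclideanLin A.transpose u) v := by
  have := Matrix.toEuclideanLin_conjTranspose_eq_adjoint A
  rw [Matrix.conjTranspose_eq_transpose_of_trivial] at this
  rw [this, LinearMap.adjoint_inner_left]

variable {K : Set (EuclideanSpace ℝ (Fin n))}
  {L M : EuclideanSpace ℝ (Fin n) → Matrix (Fin n) (Fin n) ℝ}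
  {E S : EuclideanSpace ℝ (Fin n) → ℝ}

theorem IsNondegenerateMetriplecticOn.inner_energy_field
    (h : IsNondegenerateMetriplecticOn K L M E S) {y : V} (hy : y ∈ K) :
    inner ℝ (∇ E y) (metriplecticField L M E S y) = 0 := by
  have hM : (M y).transpose = M y := by
    have := (h.posSemidef y hy).isHermitian.eq
    rwa [Matrix.conjTranspose_eq_transpose_of_trivial] at this
  have hL : inner ℝ (∇ E y) (Matrix.toEuclideanLin (L y) (∇ E y)) = 0 := by
    have h1 := inner_toEuclideanLin (L y) (∇ E y) (∇ E y)
    rw [h.skew y hy, map_neg, LinearMap.neg_apply, inner_neg_left, real_inner_comm] at h1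
    rw [real_inner_comm]
    linarith
  rw [metriplecticField, inner_add_right, hL, inner_toEuclideanLin (M y), hM,
    h.M_gradient_energy y hy, inner_zero_left, add_zero]

theorem IsNondegenerateMetriplecticOn.inner_entropy_field_nonneg
    (h : IsNondegenerateMetriplecticOn K L M E S) {y : V} (hy : y ∈ K) :
    0 ≤ inner ℝ (∇ S y) (metriplecticField L M E S y) := by
  have hL : inner ℝ (∇ S y) (Matrix.toEuclideanLin (L y) (∇ E y)) = 0 := by
    rw [inner_toEuclideanLin, h.skew y hy, map_neg, LinearMap.neg_apply,
      h.L_gradient_entropy y hy, neg_zero, inner_zero_left]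
  rw [metriplecticField, inner_add_right, hL, zero_add]
  have := (h.posSemidef y hy).dotProduct_mulVec_nonneg (∇ S y).ofLp
  rw [EuclideanSpace.inner_eq_star_dotProduct, ofLp_toEuclideanLin,
    dotProduct_comm]
  exact this

/-- Where the two gradients are parallel, the metriplectic field vanishes. -/
theorem IsNondegenerateMetriplecticOn.field_eq_zero
    (h : IsNondegenerateMetriplecticOn K L M E S) {y : V} (hy : y ∈ K)
    (hpar : projOff (∇ E y) (∇ S y) = 0) : metriplecticField L M E S y = 0 := by
  obtain ⟨a, ha⟩ : ∃ a : ℝ, ∇ S y = a • ∇ E y := by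
    refine ⟨(‖∇ E y‖ ^ 2)⁻¹ * inner ℝ (∇ E y) (∇ S y), ?_⟩
    rw [projOff, sub_eq_zero] at hpar
    rw [mul_smul]
    exact hpar
  have ha0 : a ≠ 0 := by
    rintro rfl
    exact h.gradient_entropy_ne_zero y hy (by rw [ha, zero_smul])
  have hL := h.L_gradient_entropy y hy
  rw [ha, map_smul, smul_eq_zero_iff_right ha0] at hL
  rw [metriplecticField, hL, ha, map_smul, h.M_gradient_energy y hy, smul_zero, add_zero]

theorem contDiff_toEuclideanLin :
    ContDiff ℝ 1 fun p : (Fin n → Fin n → ℝ) × V => Matrix.toEuclideanLin (Matrix.of p.1) p.2 := by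
  rw [contDiff_euclidean]
  intro i
  simp only [ofLp_toEuclideanLin, Matrix.mulVec, dotProduct, Matrix.of_apply]
  fun_prop

theorem lipschitzNear_toEuclideanLin {A : V → Matrix (Fin n) (Fin n) ℝ} {g : V → V} {y : V}
    (hA : ∀ i j, ContDiffAt ℝ 1 (fun z => A z i j) y) (hg : LipschitzNear g y) :
    LipschitzNear (fun z => Matrix.toEuclideanLin (A z) (g z)) y := by
  have hA' : LipschitzNear (fun z => (fun i j => A z i j : Fin n → Fin n → ℝ)) y :=
    ContDiffAt.lipschitzNear (contDiffAt_pi.2 fun i => contDiffAt_pi.2 fun j => hA i j)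
  exact LipschitzNear.comp
    (g := fun p : (Fin n → Fin n → ℝ) × V => Matrix.toEuclideanLin (Matrix.of p.1) p.2)
    (f := fun z => ((fun i j => A z i j : Fin n → Fin n → ℝ), g z))
    contDiff_toEuclideanLin.contDiffAt.lipschitzNear (hA'.prodMk hg)

theorem lipschitzNear_metriplecticField {y : V}
    (hL : ∀ i j, ContDiffAt ℝ 1 (fun z => L z i j) y)
    (hM : ∀ i j, ContDiffAt ℝ 1 (fun z => M z i j) y)
    (hE : LipschitzNear (∇ E) y) (hS : LipschitzNear (∇ S) y) :
    LipschitzNear (metriplecticField L M E S) y := by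
  have hadd : ContDiff ℝ 1 fun p : V × V => p.1 + p.2 := contDiff_fst.add contDiff_snd
  exact LipschitzNear.comp (g := fun p : V × V => p.1 + p.2)
    (f := fun z => (Matrix.toEuclideanLin (L z) (∇ E z), Matrix.toEuclideanLin (M z) (∇ S z)))
    hadd.contDiffAt.lipschitzNear
    ((lipschitzNear_toEuclideanLin hL hE).prodMk (lipschitzNear_toEuclideanLin hM hS))

/-! ### Neural metriplectic data of rank one -/

theorem gradientProjector_mulVec (f : V → ℝ) (y v : V) :
    (gradientProjector f y).mulVec v.ofLp = (projOff (∇ f y) v).ofLp := by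
  rw [gradientProjector, Matrix.sub_mulVec, Matrix.one_mulVec, Matrix.smul_mulVec,
    Matrix.vecMulVec_mulVec, projOff, EuclideanSpace.inner_eq_star_dotProduct, dotProduct_comm]
  ext i
  simp

theorem gradientProjector_transpose (f : V → ℝ) (y : V) :
    (gradientProjector f y).transpose = gradientProjector f y := by
  rw [gradientProjector, Matrix.transpose_sub, Matrix.transpose_one, Matrix.transpose_smul,
    Matrix.transpose_vecMulVec]

/-- The matrix `P_e b (c cᵀ) bᵀ P_e` for a single column `b` and a scalar `c`. -/
theorem gradientProjector_rankOne (f : V → ℝ) (y b : V) (c : ℝ) :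
    gradientProjector f y * ((Matrix.of fun i (_ : Fin 1) => b i) *
      ((Matrix.of fun (_ _ : Fin 1) => c) * (Matrix.of fun (_ _ : Fin 1) => c).transpose) *
      (Matrix.of fun i (_ : Fin 1) => b i).transpose) * gradientProjector f y =
    Matrix.vecMulVec (c • (projOff (∇ f y) b).ofLp) (c • (projOff (∇ f y) b).ofLp) := by
  have h : (Matrix.of fun i (_ : Fin 1) => b i) *
      ((Matrix.of fun (_ _ : Fin 1) => c) * (Matrix.of fun (_ _ : Fin 1) => c).transpose) *
      (Matrix.of fun i (_ : Fin 1) => b i).transpose =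
      Matrix.vecMulVec (c • b.ofLp) (c • b.ofLp) := by
    ext i j
    simp [Matrix.mul_apply, Matrix.vecMulVec_apply]
    ring
  rw [h, Matrix.mul_vecMulVec, Matrix.vecMulVec_mul, ← Matrix.mulVec_transpose,
    gradientProjector_transpose, Matrix.mulVec_smul, gradientProjector_mulVec]

theorem exists_isNeuralMetriplecticData {σ : ℝ → ℝ} (hσ : ContDiff ℝ ∞ σ) (hn : 0 < n)
    (hE : IsTwoLayerNetwork σ E) (hS : IsTwoLayerNetwork σ S) {b : V → V} {c : V → ℝ}
    (hb : ∀ i, IsTwoLayerNetwork σ (fun y => b y i)) (hc : IsTwoLayerNetwork σ c) :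
    ∃ L' M' : V → Matrix (Fin n) (Fin n) ℝ, IsNeuralMetriplecticData σ L' M' E S ∧
      (∀ y, metriplecticField L' M' E S y = rankOneVelocity (∇ E y) (∇ S y) (b y) (c y)) ∧
      ∀ K : Set V, (∀ y ∈ K, ∇ E y ≠ 0 ∧ ∇ S y ≠ 0) →
        IsNondegenerateMetriplecticOn K L' M' E S := by
  set q : V → V := fun y => projOff (∇ E y) (b y) with hq
  set M' : V → Matrix (Fin n) (Fin n) ℝ := fun y =>
    Matrix.vecMulVec (c y • (q y).ofLp) (c y • (q y).ofLp) with hM'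
  have happly : ∀ y v : V, Matrix.toEuclideanLin (M' y) v = (c y ^ 2 * inner ℝ (q y) v) • q y := by
    intro y v
    ext i
    rw [ofLp_toEuclideanLin, hM', Matrix.vecMulVec_mulVec,
      EuclideanSpace.inner_eq_star_dotProduct, dotProduct_comm]
    simp
    ring
  refine ⟨fun _ => 0, M', ⟨hE, hS, ⟨fun _ => 0, fun i j => IsTwoLayerNetwork.zero σ,
    fun y i j _ => rfl, fun y => by simp⟩, 1, hn, fun y => Matrix.of fun i _ => b y i,
    fun y => Matrix.of fun _ _ => c y, fun i _ => hb i, fun _ _ => hc,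
    fun y i j hij => absurd hij (by simp [Subsingleton.elim i j]),
    fun y => (gradientProjector_rankOne E y (b y) (c y)).symm⟩, fun y => ?_, fun K hK => ?_⟩
  · rw [metriplecticField, map_zero, LinearMap.zero_apply, zero_add, happly, rankOneVelocity]
  · exact
      { skew := fun y _ => by simp
        posSemidef := fun y _ => by
          have := Matrix.posSemidef_self_mul_conjTranspose
            (Matrix.of fun i (_ : Fin 1) => (c y • (q y).ofLp) i)
          convert this using 1
          ext i j
          simp only [hM', Matrix.mul_apply, Matrix.vecMulVec_apply, Matrix.of_apply,
            Matrix.conjTranspose_apply, star_trivial, Finset.univ_unique, Finset.sum_const,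
            Finset.card_singleton, one_smul]
        differentiableAt_energy := fun y _ => (hE.contDiff hσ).differentiable (by simp) y
        differentiableAt_entropy := fun y _ => (hS.contDiff hσ).differentiable (by simp) y
        L_gradient_entropy := fun y _ => by simp
        M_gradient_energy := fun y hy => by
          rw [happly, hq, real_inner_comm, inner_projOff_self (hK y hy).1, mul_zero, zero_smul]
        gradient_energy_ne_zero := fun y hy => (hK y hy).1
        gradient_entropy_ne_zero := fun y hy => (hK y hy).2 }

end Metriplectic

/-! ### The approximating trajectory -/

section Approximation

open Set Filter Topology
open scoped NNReal

variable {n : ℕ}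

local notation "V" => EuclideanSpace ℝ (Fin n)

theorem EuclideanSpace.norm_le_of_forall_abs_le {v : V} {a : ℝ} (ha : 0 ≤ a)
    (h : ∀ i, |v i| ≤ a) : ‖v‖ ≤ (n + 1) * a := by
  rw [EuclideanSpace.norm_eq]
  refine Real.sqrt_le_iff.2 ⟨by positivity, ?_⟩
  calc ∑ i, ‖v i‖ ^ 2 ≤ ∑ _i : Fin n, a ^ 2 := by
        gcongr with i
        exact h i
    _ = n * a ^ 2 := by simp
    _ ≤ ((n + 1) * a) ^ 2 := by
        rw [mul_pow]
        gcongr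
        nlinarith [(Nat.cast_nonneg n : (0 : ℝ) ≤ n)]

theorem contDiff_one_gradient {f : V → ℝ} (hf : ContDiff ℝ ∞ f) : ContDiff ℝ 1 (∇ f) :=
  (InnerProductSpace.toDual ℝ V).symm.contDiff.comp
    ((contDiff_infty_iff_fderiv.1 hf).2.of_le (by simp))

theorem exists_pos_forall_le_norm {K : Set V} (hK : IsCompact K) {g : V → V}
    (hg : Continuous g) (h0 : ∀ y ∈ K, g y ≠ 0) : ∃ μ > 0, ∀ y ∈ K, μ ≤ ‖g y‖ :=
  hK.exists_forall_le' (f := fun y => ‖g y‖) hg.norm.continuousOn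
    fun y hy => norm_pos_iff.2 (h0 y hy)

theorem ne_zero_of_norm_sub_le {u v : V} {κ μ : ℝ} (h : ‖u - v‖ ≤ κ) (hμ : μ ≤ ‖v‖)
    (hκ : κ < μ) : u ≠ 0 := by
  rintro rfl
  rw [zero_sub, norm_neg] at h
  linarith

theorem exists_vector_network_near {σ : ℝ → ℝ} (hσ : ContDiff ℝ ∞ σ)
    (hpoly : ¬ ∃ p : Polynomial ℝ, ∀ s, σ s = p.eval s) {K : Set V} (hK : IsCompact K)
    {g : V → V} (hg : ContinuousOn g K) {κ : ℝ} (hκ : 0 < κ) :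
    ∃ b : V → V, (∀ i, IsTwoLayerNetwork σ (fun y => b y i)) ∧ ∀ y ∈ K, ‖b y - g y‖ ≤ κ := by
  have hgi : ∀ i, ContinuousOn (fun y => g y i) K := fun i =>
    (EuclideanSpace.proj i : V →L[ℝ] ℝ).continuous.comp_continuousOn hg
  choose b hb hbg using fun i => exists_network_near hσ hpoly hK (hgi i)
    (κ := κ / (n + 1)) (by positivity)
  refine ⟨fun y => WithLp.toLp 2 fun i => b i y, hb, fun y hy => ?_⟩
  calc ‖WithLp.toLp 2 (fun i => b i y) - g y‖ ≤ (n + 1) * (κ / (n + 1)) :=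
        EuclideanSpace.norm_le_of_forall_abs_le (by positivity) fun i => hbg i y hy
    _ = κ := by field_simp

/-- The rank-one field with network data is `C¹` where the energy gradient does not vanish. -/
theorem contDiffAt_rankOneVelocity_network {σ : ℝ → ℝ} (hσ : ContDiff ℝ ∞ σ) {E S c : V → ℝ}
    {b : V → V} (hE : IsTwoLayerNetwork σ E) (hS : IsTwoLayerNetwork σ S)
    (hb : ∀ i, IsTwoLayerNetwork σ (fun y => b y i)) (hc : IsTwoLayerNetwork σ c) {y : V}
    (hy : ∇ E y ≠ 0) :
    ContDiffAt ℝ 1 (fun z => rankOneVelocity (∇ E z) (∇ S z) (b z) (c z)) y :=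
  contDiffAt_rankOneVelocity (contDiff_one_gradient (hE.contDiff hσ)).contDiffAt
    (contDiff_one_gradient (hS.contDiff hσ)).contDiffAt
    (contDiff_euclidean.2 fun i => ((hb i).contDiff hσ).of_le (by simp)).contDiffAt
    ((hc.contDiff hσ).of_le (by simp)).contDiffAt hy

/-- The field of rank one with network data has trajectories confined to the part of the tube
`infDist y arc ≤ η` where the scalar factor `c` is positive, if `c` is negative on the boundary of
the tube: the zeros of `c` are equilibria. -/
theorem exists_confined_trajectory {σ : ℝ → ℝ} (hσ : ContDiff ℝ ∞ σ) {E S c : V → ℝ}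
    {b : V → V} (hE : IsTwoLayerNetwork σ E) (hS : IsTwoLayerNetwork σ S)
    (hb : ∀ i, IsTwoLayerNetwork σ (fun y => b y i)) (hc : IsTwoLayerNetwork σ c)
    {arc : Set V} {η : ℝ} (hN : IsCompact {y | Metric.infDist y arc ≤ η})
    (hE0 : ∀ y, Metric.infDist y arc ≤ η → ∇ E y ≠ 0)
    (hneg : ∀ y, Metric.infDist y arc = η → c y < 0) {x₀ : V}
    (hx₀ : Metric.infDist x₀ arc < η) (hpos : 0 < c x₀) :
    ∃ x : ℝ → V, x 0 = x₀ ∧ ∀ t, Metric.infDist (x t) arc ≤ η ∧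
      HasDerivAt x (rankOneVelocity (∇ E (x t)) (∇ S (x t)) (b (x t)) (c (x t))) t := by
  have hcc : Continuous c := (hc.contDiff hσ).continuous
  have hd : Continuous fun y => Metric.infDist y arc := Metric.continuous_infDist_pt arc
  set G : Set V := {y | Metric.infDist y arc < η} ∩ {y | 0 < c y} with hG
  have hGo : IsOpen G := (isOpen_lt hd continuous_const).inter (isOpen_lt continuous_const hcc)
  have hGc : closure G ⊆ {y | Metric.infDist y arc ≤ η} ∩ {y | 0 ≤ c y} :=
    closure_minimal (fun y hy => ⟨hy.1.out.le, hy.2.out.le⟩)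
      ((isClosed_le hd continuous_const).inter (isClosed_le continuous_const hcc))
  obtain ⟨C, hC⟩ := exists_lipschitzOnWith_of_lipschitzNear hN fun y hy =>
    (contDiffAt_rankOneVelocity_network hσ hE hS hb hc (hE0 y hy)).lipschitzNear
  have hfr : ∀ y ∈ frontier G, rankOneVelocity (∇ E y) (∇ S y) (b y) (c y) = 0 := by
    intro y hy
    rw [frontier, hGo.interior_eq] at hy
    have hyN : Metric.infDist y arc ≤ η := (hGc hy.1).1
    have hyc : 0 ≤ c y := (hGc hy.1).2
    have hlt : Metric.infDist y arc < η := lt_of_le_of_ne hyN fun h => (hneg y h).not_ge hyc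
    have hy0 : c y = 0 := by
      by_contra hne
      exact hy.2 ⟨hlt, lt_of_le_of_ne hyc (Ne.symm hne)⟩
    simp [rankOneVelocity, hy0]
  obtain ⟨x, hx0, hx⟩ := exists_trajectory_of_frontier hN (hGc.trans inter_subset_left) hC hfr
    (x₀ := x₀) ⟨hx₀, hpos⟩
  exact ⟨x, hx0, fun t => ⟨le_of_lt (hx t).1.1, (hx t).2⟩⟩

/-- A compact arc has a compact tube around it on which a property that holds near its points
holds. -/
theorem exists_tube {arc : Set V} (harc : IsCompact arc) (hne : arc.Nonempty) {P : V → Prop}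
    (hP : ∀ y ∈ arc, ∀ᶠ z in 𝓝 y, P z) :
    ∃ η : ℝ, 0 < η ∧ η ≤ 1 ∧ IsCompact {y | Metric.infDist y arc ≤ η} ∧
      ∀ y, Metric.infDist y arc ≤ η → P y := by
  obtain ⟨η, hη, hsub⟩ := harc.exists_cthickening_subset_open (isOpen_interior (s := {y | P y}))
    fun y hy => mem_interior_iff_mem_nhds.2 (hP y hy)
  have heq : ∀ r : ℝ, 0 ≤ r → {y | Metric.infDist y arc ≤ r} = Metric.cthickening r arc := by
    intro r hr
    ext y
    rw [Metric.mem_cthickening_iff, mem_ofPred_eq, Metric.infDist,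
      ENNReal.le_ofReal_iff_toReal_le (Metric.infEDist_ne_top hne) hr]
  have hη' : 0 ≤ min η 1 := le_min hη.le zero_le_one
  refine ⟨min η 1, lt_min hη one_pos, min_le_right _ _, ?_, fun y hy => ?_⟩
  · rw [heq _ hη']
    exact harc.cthickening
  · have : y ∈ Metric.cthickening η arc := by
      rw [← heq _ hη.le]
      exact le_trans hy (min_le_left _ _)
    exact interior_subset (hsub this)

/-- The rank-one velocity depends uniformly continuously on its data along a compact set. -/
theorem exists_rankOneVelocity_near {N : Set V} (hN : IsCompact N) {e s b : V → V} {c : V → ℝ}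
    (he : ContinuousOn e N) (hs : ContinuousOn s N) (hb : ContinuousOn b N)
    (hc : ContinuousOn c N) (he0 : ∀ y ∈ N, e y ≠ 0) {δ : ℝ} (hδ : 0 < δ) :
    ∃ κ > 0, ∀ y ∈ N, ∀ (e' s' b' : V) (c' : ℝ), ‖e' - e y‖ ≤ κ → ‖s' - s y‖ ≤ κ →
      ‖b' - b y‖ ≤ κ → |c' - c y| ≤ κ →
      dist (rankOneVelocity e' s' b' c') (rankOneVelocity (e y) (s y) (b y) (c y)) ≤ δ := by
  set g : V → V × V × V × ℝ := fun y => (e y, s y, b y, c y) with hg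
  have hgN : IsCompact (g '' N) :=
    hN.image_of_continuousOn (he.prodMk (hs.prodMk (hb.prodMk hc)))
  have hΨ : ∀ p ∈ g '' N, ContinuousAt
      (fun p : V × V × V × ℝ => rankOneVelocity p.1 p.2.1 p.2.2.1 p.2.2.2) p := by
    rintro _ ⟨y, hy, rfl⟩
    exact (contDiffAt_rankOneVelocity (k := 1) contDiffAt_fst contDiffAt_snd.fst
      contDiffAt_snd.snd.fst contDiffAt_snd.snd.snd (he0 y hy)).continuousAt
  obtain ⟨κ, hκ, h⟩ := Metric.mem_uniformity_dist.1
    (hgN.uniformContinuousAt_of_continuousAt _ hΨ (Metric.dist_mem_uniformity hδ))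
  refine ⟨κ / 2, half_pos hκ, fun y hy e' s' b' c' h1 h2 h3 h4 => ?_⟩
  have hdist : dist (g y) (e', s', b', c') < κ := by
    refine lt_of_le_of_lt ?_ (half_lt_self hκ)
    rw [dist_comm, Prod.dist_eq, Prod.dist_eq, Prod.dist_eq]
    simp only [dist_eq_norm, max_le_iff]
    exact ⟨h1, h2, h3, h4⟩
  have := h hdist ⟨y, hy, rfl⟩
  rw [mem_ofPred_eq, dist_comm] at this
  exact this.le

end Approximation

section Shadowing

open Set Filter Topology
open scoped NNReal

variable {n : ℕ}

local notation "V" => EuclideanSpace ℝ (Fin n)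

/-- A trajectory of a field `v` that conserves `E`, does not decrease `S`, and along which the two
gradients are independent is approximated, on a bounded time interval, by the trajectory of a
rank-one field with network data. The latter exists for all times and stays in a compact tube `N`
around the arc; moreover the network gradients do not vanish on `N` or on a prescribed compact set
`Z` where the gradients of `E` and `S` do not vanish. -/
theorem exists_network_trajectory_near {σ : ℝ → ℝ} (hσ : ContDiff ℝ ∞ σ)
    (hpoly : ¬ ∃ p : Polynomial ℝ, ∀ s, σ s = p.eval s) {E S : V → ℝ}
    (hE : ContDiff ℝ 1 E) (hS : ContDiff ℝ 1 S) (hE_lip : ∃ c, LipschitzWith c (∇ E))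
    (hS_lip : ∃ c, LipschitzWith c (∇ S)) {v : V → V} {x : ℝ → V} {T : ℝ} (hT : 0 ≤ T)
    (hx : ∀ t ∈ Icc 0 T, HasDerivWithinAt x (v (x t)) (Ici 0) t)
    (hv : ∀ t ∈ Icc 0 T, LipschitzNear v (x t))
    (hvE : ∀ t ∈ Icc 0 T, inner ℝ (∇ E (x t)) (v (x t)) = 0)
    (hvS : ∀ t ∈ Icc 0 T, 0 ≤ inner ℝ (∇ S (x t)) (v (x t)))
    (hE0 : ∀ t ∈ Icc 0 T, ∇ E (x t) ≠ 0)
    (hind : ∀ t ∈ Icc 0 T, projOff (∇ E (x t)) (∇ S (x t)) ≠ 0)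
    {Z : Set V} (hZ : IsCompact Z) (hZE : ∀ y ∈ Z, ∇ E y ≠ 0) (hZS : ∀ y ∈ Z, ∇ S y ≠ 0)
    {ε : ℝ} (hε : 0 < ε) :
    ∃ (E' S' c : V → ℝ) (b : V → V) (N : Set V) (x' : ℝ → V),
      IsTwoLayerNetwork σ E' ∧ IsTwoLayerNetwork σ S' ∧ IsTwoLayerNetwork σ c ∧
      (∀ i, IsTwoLayerNetwork σ (fun y => b y i)) ∧ IsCompact N ∧
      (∀ y ∈ N, Metric.infDist y (x '' Icc 0 T) ≤ 1) ∧
      (∀ y ∈ Z ∪ N, ∇ E' y ≠ 0 ∧ ∇ S' y ≠ 0) ∧ x' 0 = x 0 ∧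
      (∀ t, x' t ∈ N ∧
        HasDerivAt x' (rankOneVelocity (∇ E' (x' t)) (∇ S' (x' t)) (b (x' t)) (c (x' t))) t) ∧
      ∀ t ∈ Icc 0 T, dist (x' t) (x t) ≤ ε := by
  set arc : Set V := x '' Icc 0 T with harc_def
  have hEc := continuous_gradient hE
  have hSc := continuous_gradient hS
  have hxc : ContinuousOn x (Icc 0 T) := fun t ht =>
    (hx t ht).continuousWithinAt.mono Icc_subset_Ici_self
  have harc : IsCompact arc := isCompact_Icc.image_of_continuousOn hxc
  have h0T : (0 : ℝ) ∈ Icc 0 T := ⟨le_rfl, hT⟩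
  have hx0 : x 0 ∈ arc := mem_image_of_mem x h0T
  have hne : arc.Nonempty := ⟨_, hx0⟩
  -- The tube on which all the velocities are defined and Lipschitz.
  obtain ⟨η, hη, hη1, hN, hNP⟩ := exists_tube harc hne
    (P := fun y => LipschitzNear v y ∧ ∇ E y ≠ 0 ∧ projOff (∇ E y) (∇ S y) ≠ 0) (by
      rintro _ ⟨t, ht, rfl⟩
      have hp : ContinuousAt (fun y => projOff (∇ E y) (∇ S y)) (x t) :=
        ContinuousAt.comp (g := fun p : V × V => projOff p.1 p.2)
          (f := fun y => (∇ E y, ∇ S y)) (contDiffAt_projOff (k := 1) contDiffAt_fst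
            contDiffAt_snd (hE0 t ht)).continuousAt (hEc.prodMk hSc).continuousAt
      exact (hv t ht).eventually.and
        ((hEc.continuousAt.eventually_ne (hE0 t ht)).and (hp.eventually_ne (hind t ht))))
  set N : Set V := {y | Metric.infDist y arc ≤ η} with hN_def
  have hNE : ∀ y ∈ N, ∇ E y ≠ 0 := fun y hy => (hNP y hy).2.1
  have hNp : ∀ y ∈ N, projOff (∇ E y) (∇ S y) ≠ 0 := fun y hy => (hNP y hy).2.2
  have hNS : ∀ y ∈ N, ∇ S y ≠ 0 := fun y hy h => hNp y hy (by simp [projOff, h])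
  -- `h` extends the velocity along the arc; `w` points, within the level set
  -- of the energy, in the direction of steepest increase of entropy.
  set h : V → V := fun y => velocityWithRates (∇ E y) (∇ S y) (v y) |inner ℝ (∇ S y) (v y)|
    with hh
  set w : V → V := fun y => velocityWithRates (∇ E y) (∇ S y) 0 1 with hw
  have hglip : ∀ y ∈ N, LipschitzNear (fun z => (∇ E z, ∇ S z, v z)) y := fun y hy =>
    (hE_lip.choose_spec.lipschitzNear y).prodMk
      ((hS_lip.choose_spec.lipschitzNear y).prodMk (hNP y hy).1)
  have hwlip : ∀ y ∈ N, LipschitzNear w y := fun y hy =>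
    LipschitzNear.comp (g := fun p : V × V × V => velocityWithRates p.1 p.2.1 0 1)
      (f := fun z => (∇ E z, ∇ S z, v z))
      (contDiffAt_velocityWithRates contDiffAt_fst contDiffAt_snd.fst contDiffAt_const
        contDiffAt_const (hNE y hy) (hNp y hy)).lipschitzNear (hglip y hy)
  have habs : LipschitzWith 1 fun r : ℝ => |r| := lipschitzWith_one_norm
  have hulip : ∀ y ∈ N, LipschitzNear (fun z => |inner ℝ (∇ S z) (v z)|) y := fun y hy =>
    LipschitzNear.comp (g := fun r : ℝ => |r|) (f := fun z => inner ℝ (∇ S z) (v z))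
      (habs.lipschitzNear _)
      (LipschitzNear.comp (g := fun p : V × V × V => inner ℝ p.2.1 p.2.2)
        (f := fun z => (∇ E z, ∇ S z, v z))
        (contDiffAt_snd.fst.inner ℝ contDiffAt_snd.snd).lipschitzNear (hglip y hy))
  have hhlip : ∀ y ∈ N, LipschitzNear h y := fun y hy =>
    LipschitzNear.comp
      (g := fun p : (V × V × V) × ℝ => velocityWithRates p.1.1 p.1.2.1 p.1.2.2 p.2)
      (f := fun z => ((∇ E z, ∇ S z, v z), |inner ℝ (∇ S z) (v z)|))
      (contDiffAt_velocityWithRates contDiffAt_fst.fst contDiffAt_fst.snd.fst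
        contDiffAt_fst.snd.snd contDiffAt_snd (hNE y hy) (hNp y hy)).lipschitzNear
      ((hglip y hy).prodMk (hulip y hy))
  obtain ⟨C, hC⟩ := exists_lipschitzOnWith_of_lipschitzNear hN hhlip
  have hwc : ContinuousOn w N := fun y hy => (hwlip y hy).continuousAt.continuousWithinAt
  have hhc : ContinuousOn h N := hC.continuousOn
  obtain ⟨W, hW⟩ := hN.exists_bound_of_continuousOn hwc
  have hx0N : x 0 ∈ N := by
    rw [hN_def, mem_ofPred_eq, Metric.infDist_zero_of_mem hx0]
    exact hη.le
  have hW0 : 0 ≤ W := (norm_nonneg _).trans (hW _ hx0N)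
  have hhx : ∀ t ∈ Icc 0 T, h (x t) = v (x t) := fun t ht => by
    rw [hh]
    beta_reduce
    rw [abs_of_nonneg (hvS t ht), velocityWithRates_eq (hvE t ht)]
  -- `δ` is the rate of the additional entropy production and the accuracy of the network field.
  set g₁ : ℝ := gronwallBound 0 C 1 T with hg₁
  have hg₁0 : 0 ≤ g₁ := by
    have := gronwallBound_mono (δ := 0) (ε := 1) (K := C) le_rfl zero_le_one C.2 hT
    rwa [gronwallBound_x0] at this
  set m : ℝ := min ε (η / 3) with hm
  have hm0 : 0 < m := lt_min hε (by positivity)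
  set δ : ℝ := m / ((1 + W) * (g₁ + 1)) with hδ_def
  have hδ : 0 < δ := by positivity
  have hδm : δ * (1 + W) * g₁ < m := by
    have : δ * (1 + W) * (g₁ + 1) = m := by rw [hδ_def]; field_simp
    have h2 : 0 < δ * (1 + W) := by positivity
    nlinarith
  -- The exact rank-one data: the column `b₀` and the scalar `c₀`.
  set b₀ : V → V := fun y => h y + δ • w y with hb₀
  have hb₀_eq : ∀ y, b₀ y = velocityWithRates (∇ E y) (∇ S y) (v y)
      (|inner ℝ (∇ S y) (v y)| + δ) := fun y => (velocityWithRates_add _ _ _ _ _).symm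
  have hb₀E : ∀ y ∈ N, inner ℝ (∇ E y) (b₀ y) = 0 := fun y hy => by
    rw [hb₀_eq, inner_velocityWithRates_left (hNE y hy)]
  have hb₀S : ∀ y ∈ N, δ ≤ inner ℝ (∇ S y) (b₀ y) := fun y hy => by
    rw [hb₀_eq, inner_velocityWithRates_right (hNE y hy) (hNp y hy)]
    linarith [abs_nonneg (inner ℝ (∇ S y) (v y))]
  have hb₀c : ContinuousOn b₀ N := hhc.add (hwc.const_smul δ)
  have hsc : ContinuousOn (fun y => inner ℝ (∇ S y) (b₀ y)) N := hSc.continuousOn.inner hb₀c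
  set χ : V → ℝ := fun y => min 1 (2 - 3 * Metric.infDist y arc / η) with hχ
  have hχc : Continuous χ := continuous_const.min (continuous_const.sub
    ((continuous_const.mul (Metric.continuous_infDist_pt arc)).div_const η))
  set c₀ : V → ℝ := fun y => χ y * (Real.sqrt (inner ℝ (∇ S y) (b₀ y)))⁻¹ with hc₀
  have hsqrt : ∀ y ∈ N, 0 < Real.sqrt (inner ℝ (∇ S y) (b₀ y)) := fun y hy =>
    Real.sqrt_pos.2 (hδ.trans_le (hb₀S y hy))
  have hc₀c : ContinuousOn c₀ N := hχc.continuousOn.mul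
    (hsc.sqrt.inv₀ fun y hy => (hsqrt y hy).ne')
  obtain ⟨B, hB⟩ := hN.exists_bound_of_continuousOn hsc.sqrt
  set l : ℝ := (|B| + 1)⁻¹ with hl
  have hl0 : 0 < l := by positivity
  have hlb : ∀ y ∈ N, l ≤ (Real.sqrt (inner ℝ (∇ S y) (b₀ y)))⁻¹ := fun y hy => by
    refine inv_anti₀ (hsqrt y hy) ?_
    have := hB y hy
    rw [Real.norm_of_nonneg (hsqrt y hy).le] at this
    linarith [le_abs_self B]
  -- The accuracy of the networks.
  obtain ⟨κ₁, hκ₁, hκ⟩ := exists_rankOneVelocity_near hN hEc.continuousOn hSc.continuousOn hb₀c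
    hc₀c hNE hδ
  have hZN : IsCompact (Z ∪ N) := hZ.union hN
  obtain ⟨μ, hμ, hμE⟩ := exists_pos_forall_le_norm hZN hEc fun y hy =>
    hy.elim (hZE y) (hNE y)
  obtain ⟨ν, hν, hνS⟩ := exists_pos_forall_le_norm hZN hSc fun y hy =>
    hy.elim (hZS y) (hNS y)
  set κ : ℝ := min κ₁ (min (μ / 2) (min (ν / 2) (l / 2))) with hκ_def
  have hκ0 : 0 < κ := by positivity
  have hκκ₁ : κ ≤ κ₁ := min_le_left _ _
  have hκμ : κ < μ := lt_of_le_of_lt ((min_le_right _ _).trans (min_le_left _ _))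
    (half_lt_self hμ)
  have hκν : κ < ν := lt_of_le_of_lt
    ((min_le_right _ _).trans ((min_le_right _ _).trans (min_le_left _ _))) (half_lt_self hν)
  have hκl : κ < l := lt_of_le_of_lt
    ((min_le_right _ _).trans ((min_le_right _ _).trans (min_le_right _ _))) (half_lt_self hl0)
  obtain ⟨E', hE', hEE'⟩ := exists_network_gradient_near hσ hpoly hZN hE hκ0
  obtain ⟨S', hS', hSS'⟩ := exists_network_gradient_near hσ hpoly hZN hS hκ0
  obtain ⟨c, hc, hcc⟩ := exists_network_near hσ hpoly hN hc₀c hκ0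
  obtain ⟨b, hb, hbb⟩ := exists_vector_network_near hσ hpoly hN hb₀c hκ0
  have hE'0 : ∀ y ∈ Z ∪ N, ∇ E' y ≠ 0 := fun y hy =>
    ne_zero_of_norm_sub_le (hEE' y hy) (hμE y hy) hκμ
  have hS'0 : ∀ y ∈ Z ∪ N, ∇ S' y ≠ 0 := fun y hy =>
    ne_zero_of_norm_sub_le (hSS' y hy) (hνS y hy) hκν
  have hneg : ∀ y, Metric.infDist y arc = η → c y < 0 := by
    intro y hy
    have hyN : y ∈ N := hy.le
    have h1 := (abs_le.1 (hcc y hyN)).2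
    have h2 : χ y = -1 := by
      simp only [hχ, hy, mul_div_assoc, div_self hη.ne']
      norm_num
    have h3 := hlb y hyN
    simp only [hc₀, h2] at h1
    linarith
  have hχ1 : ∀ y, Metric.infDist y arc ≤ η / 3 → χ y = 1 := by
    intro y hy
    refine min_eq_left ?_
    have : 3 * Metric.infDist y arc / η ≤ 1 := (div_le_one hη).2 (by linarith)
    linarith
  have hpos : 0 < c (x 0) := by
    have h1 := (abs_le.1 (hcc _ hx0N)).1
    have h3 := hlb _ hx0N
    simp only [hc₀] at h1
    rw [hχ1 (x 0) (by rw [Metric.infDist_zero_of_mem hx0]; positivity)] at h1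
    linarith
  obtain ⟨x', hx'0, hx'⟩ := exists_confined_trajectory hσ hE' hS' hb hc hN
    (fun y hy => hE'0 y (Or.inr hy)) hneg
    (by rw [Metric.infDist_zero_of_mem hx0]; exact hη) hpos
  refine ⟨E', S', c, b, N, x', hE', hS', hc, hb, hN, fun y hy => le_trans hy hη1,
    fun y hy => ⟨hE'0 y hy, hS'0 y hy⟩, hx'0, hx', ?_⟩
  have htube := dist_le_of_trajectories_in_tube (h := h)
    (g := fun y => rankOneVelocity (∇ E' y) (∇ S' y) (b y) (c y)) (N := N) (C := C)
    (ε := δ * (1 + W)) (r := η / 3) (T := T) (x := x) (y := x') (by positivity) (by positivity) hC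
    ?_ (fun t ht => by rw [hhx t ht]; exact hx t ht) (fun t _ => (hx' t).2.hasDerivWithinAt) hx'0
    (hδm.trans_le (min_le_right _ _))
  · exact fun t ht => (htube t ht).trans (hδm.le.trans (min_le_left _ _))
  · intro t ht z hz
    have hzd : Metric.infDist z arc ≤ η / 3 :=
      (Metric.infDist_le_dist_of_mem (mem_image_of_mem x ht)).trans hz
    have hzN : z ∈ N := hzd.trans (by linarith)
    refine ⟨hzN, ?_⟩
    have h1 := hκ z hzN _ _ _ _ ((hEE' z (Or.inr hzN)).trans hκκ₁)
      ((hSS' z (Or.inr hzN)).trans hκκ₁) ((hbb z hzN).trans hκκ₁) ((hcc z hzN).trans hκκ₁)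
    have h2 : rankOneVelocity (∇ E z) (∇ S z) (b₀ z) (c₀ z) = b₀ z := by
      simp only [hc₀]
      rw [rankOneVelocity_eq (hb₀E z hzN) (hδ.trans_le (hb₀S z hzN)), hχ1 z hzd, one_pow,
        one_smul]
    rw [h2] at h1
    have h3 : dist (b₀ z) (h z) ≤ δ * W := by
      rw [dist_eq_norm, hb₀]
      simp only [add_sub_cancel_left]
      rw [norm_smul, Real.norm_of_nonneg hδ.le]
      exact mul_le_mul_of_nonneg_left (hW z hzN) hδ.le
    calc _ ≤ _ := dist_triangle _ (b₀ z) _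
      _ ≤ δ + δ * W := add_le_add h1 h3
      _ = δ * (1 + W) := by ring

end Shadowing

/-! ### Metriplectic trajectories -/

section Trajectories

open Set Filter Topology
open scoped NNReal

variable {n : ℕ} {K : Set (EuclideanSpace ℝ (Fin n))}
  {L M : EuclideanSpace ℝ (Fin n) → Matrix (Fin n) (Fin n) ℝ}
  {E S : EuclideanSpace ℝ (Fin n) → ℝ} {x : ℝ → EuclideanSpace ℝ (Fin n)}

theorem IsMetriplecticTrajectory.continuousOn (hx : IsMetriplecticTrajectory K L M E S x) :
    ContinuousOn x (Ici 0) :=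
  fun t ht => (hx t ht).2.continuousWithinAt

theorem IsMetriplecticTrajectory.apply_zero_le (hx : IsMetriplecticTrajectory K L M E S x)
    {g : EuclideanSpace ℝ (Fin n) → ℝ} (hg : Differentiable ℝ g)
    (h : ∀ y ∈ K, 0 ≤ inner ℝ (∇ g y) (metriplecticField L M E S y)) {t : ℝ} (ht : 0 ≤ t) :
    g (x 0) ≤ g (x t) := by
  refine monotoneOn_of_hasDerivWithinAt_nonneg (f := fun t => g (x t))
    (f' := fun t => inner ℝ (∇ g (x t)) (metriplecticField L M E S (x t))) (convex_Ici 0)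
    (hg.continuous.comp_continuousOn hx.continuousOn) (fun s hs => ?_) (fun s hs => ?_)
    self_mem_Ici (mem_Ici.2 ht) ht
  · have hs' := interior_subset hs
    exact (((hg (x s)).hasGradientAt.hasFDerivAt.comp_hasDerivWithinAt s (hx s hs').2)).mono
      interior_subset
  · exact h _ (hx s (interior_subset hs)).1

/-- A trajectory is bounded, because `E` is constant and `S` nondecreasing along it. -/
theorem IsMetriplecticTrajectory.isBounded (hx : IsMetriplecticTrajectory K L M E S x)
    (hdata : IsNondegenerateMetriplecticOn K L M E S) (hE : Differentiable ℝ E)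
    (hS : Differentiable ℝ S)
    (hbdd : HasBoundedSublevelSets E ∨ HasBoundedSublevelSets (fun y => -S y)) :
    Bornology.IsBounded (x '' Ici 0) := by
  rcases hbdd with hb | hb
  · refine (hb (E (x 0))).subset ?_
    rintro _ ⟨t, ht, rfl⟩
    have := hx.apply_zero_le (g := fun y => -E y) hE.neg (fun y hy => ?_) ht
    · exact neg_le_neg_iff.1 this
    · have h1 : ∇ (fun y => -E y) y = -∇ E y := by
        simp only [gradient, fderiv_fun_neg, map_neg]
      rw [h1, inner_neg_left, hdata.inner_energy_field hy, neg_zero]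
  · refine (hb (-S (x 0))).subset ?_
    rintro _ ⟨t, ht, rfl⟩
    exact neg_le_neg (hx.apply_zero_le hS (fun y hy => hdata.inner_entropy_field_nonneg hy) ht)

/-- A trajectory that meets an equilibrium is constant. -/
theorem IsMetriplecticTrajectory.eq_of_field_eq_zero
    (hx : IsMetriplecticTrajectory K L M E S x)
    (hlip : ∀ y ∈ K, LipschitzNear (metriplecticField L M E S) y) {t₀ : ℝ} (ht₀ : 0 ≤ t₀)
    (h0 : metriplecticField L M E S (x t₀) = 0) {t : ℝ} (ht : 0 ≤ t) : x t = x t₀ := by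
  set T := max t₀ t with hT
  have hsub : Icc 0 T ⊆ Ici 0 := Icc_subset_Ici_self
  have hxc := hx.continuousOn
  obtain ⟨C, hC⟩ := exists_lipschitzOnWith_of_lipschitzNear
    (isCompact_Icc.image_of_continuousOn (hxc.mono hsub)) (by
      rintro _ ⟨s, hs, rfl⟩
      exact hlip _ (hx s hs.1).1)
  have hmem : ∀ s ∈ Icc 0 T, x s ∈ x '' Icc 0 T := fun s hs => mem_image_of_mem x hs
  have ht₀T : t₀ ∈ Icc 0 T := ⟨ht₀, le_max_left _ _⟩
  rcases le_total t t₀ with h | h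
  · refine ODE_solution_unique_of_mem_Icc_left (v := fun _ => metriplecticField L M E S)
      (s := fun _ => x '' Icc 0 T) (f := x) (g := fun _ => x t₀) (a := 0) (b := t₀)
      (fun _ _ => hC) (hxc.mono Icc_subset_Ici_self) (fun s hs => ?_)
      (fun s hs => hmem s ⟨hs.1.le, hs.2.trans ht₀T.2⟩) continuousOn_const (fun s _ => ?_)
      (fun _ _ => hmem t₀ ht₀T) rfl ⟨ht, h⟩
    · exact ((hx s hs.1.le).2.hasDerivAt (Ici_mem_nhds hs.1)).hasDerivWithinAt
    · rw [h0]; exact hasDerivWithinAt_const _ _ _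
  · refine ODE_solution_unique_of_mem_Icc_right (v := fun _ => metriplecticField L M E S)
      (s := fun _ => x '' Icc 0 T) (f := x) (g := fun _ => x t₀) (a := t₀) (b := t)
      (fun _ _ => hC) (hxc.mono fun s hs => ht₀.trans hs.1) (fun s hs => ?_)
      (fun s hs => hmem s ⟨ht₀.trans hs.1, hs.2.le.trans (le_max_right _ _)⟩) continuousOn_const
      (fun s _ => ?_) (fun _ _ => hmem t₀ ht₀T) rfl ⟨h, le_rfl⟩
    · exact (hx s (ht₀.trans hs.1)).2.mono (Ici_subset_Ici.2 (ht₀.trans hs.1))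
    · rw [h0]; exact hasDerivWithinAt_const _ _ _

end Trajectories

/-! ### The error in `L²` -/

section ErrorBound

open Set

variable {V : Type*} [NormedAddCommGroup V]

/-- Two bounded curves that are `ε`-close up to the time `D² / ε²` satisfy the exponential bound in
`L²` for all times: from then on `D² T ≤ ε² T² ≤ ε² (exp T - 1)²`. -/
theorem sqrt_integral_sq_norm_sub_le {x y : ℝ → V} {ε D : ℝ} (hε : 0 < ε)
    (hclose : ∀ t ∈ Icc 0 (D ^ 2 / ε ^ 2), ‖x t - y t‖ ≤ ε)
    (hfar : ∀ t, 0 ≤ t → ‖x t - y t‖ ≤ D) {T : ℝ} (hT : 0 < T) :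
    Real.sqrt (∫ t in (0 : ℝ)..T, ‖x t - y t‖ ^ 2) ≤
      ε * |(1 : ℝ) / 1| *
        Real.sqrt (Real.exp (2 * 1 * T) - 2 * Real.exp (1 * T) + T + 1) := by
  have hZ : Real.exp (2 * 1 * T) - 2 * Real.exp (1 * T) + T + 1 = (Real.exp T - 1) ^ 2 + T := by
    rw [mul_one, one_mul, two_mul, Real.exp_add]
    ring
  have hexp : T ^ 2 ≤ (Real.exp T - 1) ^ 2 := by
    have := Real.add_one_le_exp T
    gcongr
    linarith
  have hint : ∀ B : ℝ, (∀ t ∈ Ioc 0 T, ‖x t - y t‖ ≤ B) →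
      ∫ t in (0 : ℝ)..T, ‖x t - y t‖ ^ 2 ≤ B ^ 2 * T := by
    intro B hB
    have := intervalIntegral.norm_integral_le_of_norm_le_const (a := 0) (b := T) (C := B ^ 2)
      (f := fun t => ‖x t - y t‖ ^ 2) (fun t ht => by
        rw [uIoc_of_le hT.le] at ht
        rw [Real.norm_of_nonneg (by positivity)]
        exact pow_le_pow_left₀ (norm_nonneg _) (hB t ht) 2)
    rw [sub_zero, abs_of_pos hT] at this
    exact (le_abs_self _).trans this
  have hmain : ∫ t in (0 : ℝ)..T, ‖x t - y t‖ ^ 2 ≤ ε ^ 2 * ((Real.exp T - 1) ^ 2 + T) := by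
    rcases le_total T (D ^ 2 / ε ^ 2) with h | h
    · refine (hint ε fun t ht => hclose t ⟨ht.1.le, ht.2.trans h⟩).trans ?_
      gcongr
      linarith [sq_nonneg (Real.exp T - 1)]
    · refine (hint D fun t ht => hfar t ht.1.le).trans ?_
      rw [div_le_iff₀ (by positivity)] at h
      calc D ^ 2 * T ≤ (T * ε ^ 2) * T := by gcongr
        _ = ε ^ 2 * T ^ 2 := by ring
        _ ≤ ε ^ 2 * ((Real.exp T - 1) ^ 2 + T) := by gcongr; linarith
  rw [hZ]
  calc Real.sqrt (∫ t in (0 : ℝ)..T, ‖x t - y t‖ ^ 2)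
      ≤ Real.sqrt (ε ^ 2 * ((Real.exp T - 1) ^ 2 + T)) := Real.sqrt_le_sqrt hmain
    _ = ε * |(1 : ℝ) / 1| * Real.sqrt ((Real.exp T - 1) ^ 2 + T) := by
        rw [Real.sqrt_mul (by positivity), Real.sqrt_sq hε.le, div_one, abs_one, mul_one]

end ErrorBound

/-! ### Approximation by neural metriplectic systems -/

theorem theorem3p5 {n : ℕ} (σ : ℝ → ℝ) (hσ : ContDiff ℝ ∞ σ)
    (hσ_poly : ¬ ∃ p : Polynomial ℝ, ∀ s, σ s = p.eval s)
    (K : Set (EuclideanSpace ℝ (Fin n))) (hK : IsClosed K)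
    (L M : EuclideanSpace ℝ (Fin n) → Matrix (Fin n) (Fin n) ℝ)
    (E S : EuclideanSpace ℝ (Fin n) → ℝ)
    (hdata : IsNondegenerateMetriplecticOn K L M E S)
    (hL : ∀ y ∈ K, ∀ i j, ContDiffAt ℝ 1 (fun z => L z i j) y)
    (hM : ∀ y ∈ K, ∀ i j, ContDiffAt ℝ 1 (fun z => M z i j) y)
    (hE : Differentiable ℝ E) (hE_lip : ∃ c, LipschitzWith c (∇ E))
    (hS : Differentiable ℝ S) (hS_lip : ∃ c, LipschitzWith c (∇ S))
    (hbdd : HasBoundedSublevelSets E ∨ HasBoundedSublevelSets (fun y => -S y))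
    (x : ℝ → EuclideanSpace ℝ (Fin n)) (hx : IsMetriplecticTrajectory K L M E S x) :
    ∃ a b : ℝ, 0 < a ∧
      ∀ ε : ℝ, 0 < ε → ∀ C : Set (EuclideanSpace ℝ (Fin n)), IsCompact C → C ⊆ K →
        ∃ (L' M' : EuclideanSpace ℝ (Fin n) → Matrix (Fin n) (Fin n) ℝ)
          (E' S' : EuclideanSpace ℝ (Fin n) → ℝ)
          (K' : Set (EuclideanSpace ℝ (Fin n))) (x' : ℝ → EuclideanSpace ℝ (Fin n)),
          IsNeuralMetriplecticData σ L' M' E' S' ∧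
          IsCompact K' ∧ C ⊆ K' ∧
          (∀ t : ℝ, 0 ≤ t → x t ∈ K') ∧
          IsNondegenerateMetriplecticOn K' L' M' E' S' ∧
          IsMetriplecticTrajectory K' L' M' E' S' x' ∧
          x' 0 = x 0 ∧
          ∀ T : ℝ, 0 < T →
            Real.sqrt (∫ t in (0 : ℝ)..T, ‖x t - x' t‖ ^ 2) ≤
              ε * |b / a| *
                Real.sqrt (Real.exp (2 * a * T) - 2 * Real.exp (a * T) + T + 1) := by
  have hE1 : ContDiff ℝ 1 E := contDiff_one_of_continuous_gradient hE hE_lip.choose_spec.continuous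
  have hS1 : ContDiff ℝ 1 S := contDiff_one_of_continuous_gradient hS hS_lip.choose_spec.continuous
  have hlip : ∀ y ∈ K, LipschitzNear (metriplecticField L M E S) y := fun y hy =>
    lipschitzNear_metriplecticField (hL y hy) (hM y hy) (hE_lip.choose_spec.lipschitzNear y)
      (hS_lip.choose_spec.lipschitzNear y)
  have hxK : ∀ t, 0 ≤ t → x t ∈ K := fun t ht => (hx t ht).1
  have hn : 0 < n := by
    rcases Nat.eq_zero_or_pos n with rfl | h
    · exact absurd (Subsingleton.elim _ _) (hdata.gradient_energy_ne_zero _ (hxK 0 le_rfl))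
    · exact h
  -- The closure of the orbit is a compact subset of `K`.
  set Γ : Set (EuclideanSpace ℝ (Fin n)) := closure (x '' Set.Ici 0) with hΓ_def
  have hbd := hx.isBounded hdata hE hS hbdd
  have hΓ : IsCompact Γ := hbd.isCompact_closure
  have hΓK : Γ ⊆ K := closure_minimal (by rintro _ ⟨t, ht, rfl⟩; exact hxK t ht) hK
  have hxΓ : ∀ t, 0 ≤ t → x t ∈ Γ := fun t ht => subset_closure ⟨t, ht, rfl⟩
  refine ⟨1, 1, one_pos, fun ε hε Q hQ hQK => ?_⟩
  have hZ : IsCompact (Q ∪ Γ) := hQ.union hΓ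
  have hZK : Q ∪ Γ ⊆ K := Set.union_subset hQK hΓK
  by_cases hpar : ∃ t₀, 0 ≤ t₀ ∧ projOff (∇ E (x t₀)) (∇ S (x t₀)) = 0
  · -- The trajectory is an equilibrium, and the column `b = 0` gives the zero field.
    obtain ⟨t₀, ht₀, hpar⟩ := hpar
    have hconst : ∀ t, 0 ≤ t → x t = x t₀ := fun t ht =>
      hx.eq_of_field_eq_zero hlip ht₀ (hdata.field_eq_zero (hxK t₀ ht₀) hpar) ht
    obtain ⟨μ, hμ, hμE⟩ := exists_pos_forall_le_norm hZ (continuous_gradient hE1) fun y hy =>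
      hdata.gradient_energy_ne_zero y (hZK hy)
    obtain ⟨ν, hν, hνS⟩ := exists_pos_forall_le_norm hZ (continuous_gradient hS1) fun y hy =>
      hdata.gradient_entropy_ne_zero y (hZK hy)
    obtain ⟨E', hE', hEE'⟩ := exists_network_gradient_near hσ hσ_poly hZ hE1 (half_pos hμ)
    obtain ⟨S', hS', hSS'⟩ := exists_network_gradient_near hσ hσ_poly hZ hS1 (half_pos hν)
    obtain ⟨L', M', hneural, hfield, hnondeg⟩ := exists_isNeuralMetriplecticData hσ hn hE' hS'
      (b := fun _ => 0) (c := fun _ => 0) (fun _ => IsTwoLayerNetwork.zero σ)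
      (IsTwoLayerNetwork.zero σ)
    refine ⟨L', M', E', S', Q ∪ Γ, fun _ => x 0, hneural, hZ, Set.subset_union_left,
      fun t ht => Or.inr (hxΓ t ht), hnondeg _ fun y hy =>
        ⟨ne_zero_of_norm_sub_le (hEE' y hy) (hμE y hy) (half_lt_self hμ),
          ne_zero_of_norm_sub_le (hSS' y hy) (hνS y hy) (half_lt_self hν)⟩,
      fun t ht => ⟨Or.inr (hxΓ 0 le_rfl), ?_⟩, rfl, fun T hT => ?_⟩
    · rw [hfield, rankOneVelocity]
      simpa using hasDerivWithinAt_const t (Set.Ici 0) (x 0)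
    · have h0 : ∀ t, 0 ≤ t → ‖x t - x 0‖ = 0 := fun t ht => by
        rw [hconst t ht, hconst 0 le_rfl, sub_self, norm_zero]
      exact sqrt_integral_sq_norm_sub_le (y := fun _ => x 0) (D := 0) hε
        (fun t ht => (h0 t ht.1).le.trans hε.le) (fun t ht => (h0 t ht).le) hT
  · push Not at hpar
    -- The discrepancy of curves in the unit neighbourhood of the orbit is at most `D`.
    obtain ⟨R, hR⟩ := hbd.subset_closedBall 0
    have hxR : ∀ t, 0 ≤ t → ‖x t‖ ≤ R := fun t ht =>
      mem_closedBall_zero_iff.1 (hR ⟨t, ht, rfl⟩)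
    set D : ℝ := R + (R + 2) with hD
    have hT : 0 ≤ D ^ 2 / ε ^ 2 := by positivity
    obtain ⟨E', S', c, b, N, x', hE', hS', hc, hb, hN, hN1, hne, hx'0, hx', hclose⟩ :=
      exists_network_trajectory_near hσ hσ_poly hE1 hS1 hE_lip hS_lip hT
        (fun t ht => (hx t ht.1).2) (fun t ht => hlip _ (hxK t ht.1))
        (fun t ht => hdata.inner_energy_field (hxK t ht.1))
        (fun t ht => hdata.inner_entropy_field_nonneg (hxK t ht.1))
        (fun t ht => hdata.gradient_energy_ne_zero _ (hxK t ht.1)) (fun t ht => hpar t ht.1)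
        hZ (fun y hy => hdata.gradient_energy_ne_zero y (hZK hy))
        (fun y hy => hdata.gradient_entropy_ne_zero y (hZK hy)) hε
    obtain ⟨L', M', hneural, hfield, hnondeg⟩ := exists_isNeuralMetriplecticData hσ hn hE' hS'
      hb hc
    refine ⟨L', M', E', S', (Q ∪ Γ) ∪ N, x', hneural, hZ.union hN,
      Set.subset_union_left.trans Set.subset_union_left, fun t ht => Or.inl (Or.inr (hxΓ t ht)),
      hnondeg _ hne, fun t _ => ⟨Or.inr (hx' t).1, ?_⟩, hx'0, fun T hT' => ?_⟩
    · rw [hfield]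
      exact (hx' t).2.hasDerivWithinAt
    · refine sqrt_integral_sq_norm_sub_le (D := D) hε (fun t ht => ?_) (fun t ht => ?_) hT'
      · rw [← dist_eq_norm, dist_comm]
        exact hclose t ht
      · have hx'R : ‖x' t‖ ≤ R + 2 := by
          have h1 : Metric.infDist (x' t) (x '' Set.Icc 0 (D ^ 2 / ε ^ 2)) < 2 :=
            (hN1 _ (hx' t).1).trans_lt one_lt_two
          have hne0 : (x '' Set.Icc 0 (D ^ 2 / ε ^ 2)).Nonempty := ⟨x 0, 0, ⟨le_rfl, hT⟩, rfl⟩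
          obtain ⟨_, ⟨s, hs, rfl⟩, hlt⟩ := (Metric.infDist_lt_iff hne0).1 h1
          calc ‖x' t‖ ≤ ‖x s‖ + ‖x' t - x s‖ := norm_le_norm_add_norm_sub' _ _
            _ ≤ R + 2 := by
              rw [← dist_eq_norm]
              exact add_le_add (hxR s hs.1) hlt.le
        exact (norm_sub_le _ _).trans (add_le_add (hxR t ht) hx'R)
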